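/- Let $\mathcal{A}_n$ be the space of real skew symmetric $n\times n$ matrices. For $R\in SO_n$ let $\mathcal{A}plog(R)$ be the set of its skew symmetric principal logarithms, i.e. of the $B\in\mathcal{A}_n$ with $\exp(B)=R$ all of whose (complex) eigenvalues have absolute value in $[0,\pi]$. Let $\mathcal{M}_{2\mu}\subset\mathcal{A}_{2\mu}$ be the set of skew symmetric orthogonal matrices of order $2\mu$. Nonzero matrices $A_1,\dots,A_s\in\mathcal{A}_n$ form an SVD system if $A_j^3=-A_j$ for every $j$ and $A_jA_h=0$ for $j\neq h$. The Singular Value Decomposition of $A\in\mathcal{A}_n$ is the decomposition $A=\sum_{j=1}^s\zeta_jA_j$ where $\zeta_1,\dots,\zeta_s$ are the distinct nonzero singular values of $A$ and $A_1,\dots,A_s$ form an SVD system. **Theorem.** Let $R\in SO_n$. 1) If $-1$ is not an eigenvalue of $R$, then $R$ has a unique skew symmetric principal logarithm. 2) If $-1$ is an eigenvalue of $R$, then its multiplicity is even, equal to $2m_1$ with $m_1\ge 1$; $\mathcal{M}_{2m_1}$ is a smooth embedded submanifold of $\mathcal{A}_{2m_1}$; and $\mathcal{A}plog(R)$ is a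 smooth embedded submanifold of $\mathcal{A}_n$ diffeomorphic to $\mathcal{M}_{2m_1}$. Moreover, let $B=\sum_{j=1}^p\theta_jB_j$ be any skew symmetric principal logarithm of $R$ with its Singular Value Decomposition. Then $\pi$ is one of the $\theta_j$ and, labelling so that $\theta_1=\pi$, $$\mathcal{A}plog(R)=\Big\{\pi W+\sum_{j=2}^p\theta_jB_j \;:\; W\in\mathcal{A}_n,\ W,B_2,\dots,B_p \text{ form an SVD system},\ W^2=B_1^2\Big\}.$$ -/

import Mathlib

open Real
open scoped Matrix ContDiff

attribute [local instance] Matrix.frobeniusNormedAddCommGroup Matrix.frobeniusNormedSpace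

noncomputable section

/-- The real vector space of skew symmetric real matrices of order `n`. -/
def SkewMatrix (n : ℕ) : Submodule ℝ (Matrix (Fin n) (Fin n) ℝ) where
  carrier := {A | Aᵀ = -A}
  add_mem' := by
    intro A B hA hB
    change (A + B)ᵀ = -(A + B)
    change Aᵀ = -A at hA
    change Bᵀ = -B at hB
    rw [Matrix.transpose_add, hA, hB, neg_add]
  zero_mem' := by simp
  smul_mem' := by
    intro c A hA
    change (c • A)ᵀ = -(c • A)
    change Aᵀ = -A at hA
    rw [Matrix.transpose_smul, hA, smul_neg]

/-- The skew symmetric principal logarithms of `R`: the real skew symmetric matrices `B` with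
`exp B = R` all of whose complex eigenvalues have absolute value at most `π`. -/
def Aplog {n : ℕ} (R : Matrix (Fin n) (Fin n) ℝ) : Set (SkewMatrix n) :=
  {B | NormedSpace.exp (B : Matrix (Fin n) (Fin n) ℝ) = R ∧
    ∀ z : ℂ, Module.End.HasEigenvalue
      (Matrix.toLin' ((B : Matrix (Fin n) (Fin n) ℝ).map (algebraMap ℝ ℂ))) z → ‖z‖ ≤ π}

/-- The skew symmetric orthogonal real matrices of order `k`. -/
def SkewOrthogonal (k : ℕ) : Set (SkewMatrix k) :=
  {M | (M : Matrix (Fin k) (Fin k) ℝ) ∈ Matrix.orthogonalGroup (Fin k) ℝ}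

/-- A family of nonzero skew symmetric matrices is an SVD system if each member satisfies
`A ^ 3 = -A` and any two different members have product zero. -/
structure IsSVDSystem {n : ℕ} {ι : Type*} (A : ι → SkewMatrix n) : Prop where
  ne_zero : ∀ j, A j ≠ 0
  cube : ∀ j, (A j : Matrix (Fin n) (Fin n) ℝ) ^ 3 = -(A j : Matrix (Fin n) (Fin n) ℝ)
  mul_eq_zero : ∀ j h, j ≠ h →
    (A j : Matrix (Fin n) (Fin n) ℝ) * (A h : Matrix (Fin n) (Fin n) ℝ) = 0

/-- `A = ∑ j, ζ j • C j` is the singular value decomposition of the skew symmetric matrix `A`: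
the `ζ j` are the distinct nonzero singular values of `A`, listed without repetition, and the `C j` form an SVD system. -/
structure IsSVD {n s : ℕ} (A : SkewMatrix n) (ζ : Fin s → ℝ) (C : Fin s → SkewMatrix n) :
    Prop where
  injective : Function.Injective ζ
  range_eq : Set.range ζ = {σ : ℝ | σ ≠ 0 ∧
    ∃ i, (Matrix.toEuclideanLin (A : Matrix (Fin n) (Fin n) ℝ)).singularValues i = σ}
  system : IsSVDSystem C
  sum_eq : A = ∑ j, ζ j • C j

section Submanifold

variable {E F : Type*} [NormedAddCommGroup E] [NormedSpace ℝ E]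
  [NormedAddCommGroup F] [NormedSpace ℝ F]

/-- `S` is a (smooth) embedded submanifold of the finite-dimensional real vector space `E`: for
some `d`, around each of its points there is a smooth chart of `E` that carries `S` onto a
`d`-dimensional linear slice. -/
def IsEmbeddedSubmanifold [FiniteDimensional ℝ E] (S : Set E) : Prop :=
  ∃ d : ℕ, ∀ x ∈ S, ∃ (φ : OpenPartialHomeomorph E E) (V : Submodule ℝ E),
    x ∈ φ.source ∧ ContDiffOn ℝ ∞ φ φ.source ∧ ContDiffOn ℝ ∞ φ.symm φ.target ∧
    Module.finrank ℝ V = d ∧ φ '' (φ.source ∩ S) = φ.target ∩ V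

/-- A map between subsets of normed spaces is smooth if, near each point of its domain, it is
the restriction of a smooth map defined on an open subset of the ambient space. -/
def IsSmoothMap {S : Set E} {T : Set F} (f : S → T) : Prop :=
  ∀ x : S, ∃ (U : Set E) (g : E → F), IsOpen U ∧ (x : E) ∈ U ∧ ContDiffOn ℝ ∞ g U ∧
    ∀ y : S, (y : E) ∈ U → g y = f y

/-- There is a bijection between `S` and `T` which is smooth together with its inverse. -/
def AreDiffeomorphic (S : Set E) (T : Set F) : Prop :=
  ∃ e : S ≃ T, IsSmoothMap e ∧ IsSmoothMap e.symm

end Submanifold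

end

/-! ### The exponential on eigenvectors of the square. -/

section ExpOnEigenvectors

variable {n : ℕ}

-- Split R = S + K into symmetric and skew parts. Orthogonality of R makes S and K commute and gives
-- K² = S² - 1. Let B be a skew principal logarithm and B²v = -θ²v with 0 ≤ θ ≤ π. Comparing exp(B)
-- = R with exp(-B) = Rᵀ yields Sv = cos θ · v and Kv = (sin θ/θ) Bv (`exists_angle_of_mem_Aplog`).
-- Thus S determines θ, and R determines Bv unless θ = π, that is, away from the eigenspace of R for
-- -1. With P the orthogonal projection onto that eigenspace, B = L + BP for a skew L depending only
-- on R (`exists_isLogSplitting`), and the logarithms are exactly the L + πW with W skew and W² = -P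
-- (`IsLogSplitting.mem_Aplog_iff`). If P = 0, only L remains.
--
-- If P ≠ 0, an orthonormal frame U of its range turns W into UMUᵀ with M skew and M² = -1, so the
-- logarithms form an injective affine image of the skew orthogonal matrices of order m = rank P
-- (`IsLogSplitting.aplog_eq_image`); the submanifold property and the diffeomorphism follow. The
-- rank m is even because R = exp(L)(1 - 2P) has determinant 1 while det exp(L) ≥ 0.
--
-- The skew orthogonal matrices are flattened near J by the Cayley-type chart X ↦ (X + J)⁻¹ + J/2,
-- which carries X² = -1 to the linear equation WJ + JW = 0 (`skewInvChart_mem_anticommuting_iff`).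
--
-- In a singular value decomposition of B, the terms with θ_j ≠ π are annihilated by P, while the
-- term with θ_k = π satisfies C_k² = -P. The other terms therefore add up to L, which gives the
-- last description (`IsSVD.aplog_eq`).

attribute [local instance] Matrix.frobeniusNormedRing Matrix.frobeniusNormedAlgebra in
theorem hasSum_exp_mulVec (B : Matrix (Fin n) (Fin n) ℝ) (v : Fin n → ℝ) :
    HasSum (fun k : ℕ => ((k.factorial : ℝ)⁻¹ • B ^ k) *ᵥ v) (NormedSpace.exp B *ᵥ v) := by
  have h := NormedSpace.exp_series_hasSum_exp' (𝕂 := ℝ) B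
  let L : Matrix (Fin n) (Fin n) ℝ →ₗ[ℝ] (Fin n → ℝ) :=
    { toFun := fun M => M *ᵥ v
      map_add' := fun M N => Matrix.add_mulVec M N v
      map_smul' := fun c M => Matrix.smul_mulVec c M v }
  exact h.map L.toAddMonoidHom L.continuous_of_finiteDimensional

theorem pow_two_mul_mulVec {B : Matrix (Fin n) (Fin n) ℝ} {v : Fin n → ℝ} {θ : ℝ}
    (h : (B * B) *ᵥ v = (-θ ^ 2) • v) (k : ℕ) :
    B ^ (2 * k) *ᵥ v = ((-1) ^ k * θ ^ (2 * k)) • v := by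
  induction k with
  | zero => simp
  | succ k ih =>
    have e : B ^ (2 * (k + 1)) = B ^ (2 * k) * (B * B) := by
      rw [← pow_two, ← pow_add]; rfl
    rw [e, ← Matrix.mulVec_mulVec, h, Matrix.mulVec_smul, ih, smul_smul]
    congr 1
    ring

/-- Even powers of B act on v by scalars, so the even terms of the series sum to a cosine on v and
the odd ones to a sine on Bv. At θ = 0 the quotient is 0 by convention, hence `h0`. -/
theorem exp_mulVec_of_sq_mulVec {B : Matrix (Fin n) (Fin n) ℝ} {v : Fin n → ℝ} {θ : ℝ}
    (h : (B * B) *ᵥ v = (-θ ^ 2) • v) (h0 : θ = 0 → B *ᵥ v = 0) :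
    NormedSpace.exp B *ᵥ v = cos θ • v + (sin θ / θ) • (B *ᵥ v) := by
  refine (hasSum_exp_mulVec B v).unique (HasSum.even_add_odd ?_ ?_)
  · convert (Real.hasSum_cos θ).smul_const v using 2 with k
    rw [Matrix.smul_mulVec, pow_two_mul_mulVec h, smul_smul]
    congr 1
    ring
  · rcases eq_or_ne θ 0 with rfl | hθ
    · have : ∀ k, B ^ (2 * k + 1) *ᵥ v = 0 := fun k => by
        rw [pow_succ, ← Matrix.mulVec_mulVec, h0 rfl, Matrix.mulVec_zero]
      simp [Matrix.smul_mulVec, this]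
    · convert ((Real.hasSum_sin θ).div_const θ).smul_const (B *ᵥ v) using 2 with k
      rw [Matrix.smul_mulVec, pow_succ', ← Matrix.mulVec_mulVec, pow_two_mul_mulVec h,
        Matrix.mulVec_smul, smul_smul]
      congr 1
      field_simp
      ring

end ExpOnEigenvectors

/-! ### Cancellation for skew matrices. -/

section SkewMatrices

variable {n : ℕ}

theorem transpose_coe_skewMatrix (B : SkewMatrix n) :
    (B : Matrix (Fin n) (Fin n) ℝ)ᵀ = -(B : Matrix (Fin n) (Fin n) ℝ) := B.2

theorem dotProduct_self_nonneg (v : Fin n → ℝ) : 0 ≤ v ⬝ᵥ v :=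
  Finset.sum_nonneg fun i _ => mul_self_nonneg (v i)

theorem mem_skewMatrix {A : Matrix (Fin n) (Fin n) ℝ} : A ∈ SkewMatrix n ↔ Aᵀ = -A := Iff.rfl

theorem dotProduct_mulVec_of_skew {B : Matrix (Fin n) (Fin n) ℝ} (hB : Bᵀ = -B)
    (v w : Fin n → ℝ) : v ⬝ᵥ (B *ᵥ w) = -((B *ᵥ v) ⬝ᵥ w) := by
  rw [Matrix.dotProduct_mulVec, ← Matrix.mulVec_transpose, hB, Matrix.neg_mulVec, neg_dotProduct]

theorem mulVec_dotProduct_self_of_skew {B : Matrix (Fin n) (Fin n) ℝ} (hB : Bᵀ = -B)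
    {v : Fin n → ℝ} {μ : ℝ} (h : (B * B) *ᵥ v = μ • v) :
    (B *ᵥ v) ⬝ᵥ (B *ᵥ v) = -μ * (v ⬝ᵥ v) := by
  have := dotProduct_mulVec_of_skew hB v (B *ᵥ v)
  rw [Matrix.mulVec_mulVec, h, dotProduct_smul, smul_eq_mul] at this
  linarith

/-- For skew B, |Bv|² = -⟨v, B²v⟩. -/
theorem mulVec_eq_zero_of_skew {B : Matrix (Fin n) (Fin n) ℝ} (hB : Bᵀ = -B)
    {v : Fin n → ℝ} (h : (B * B) *ᵥ v = 0) : B *ᵥ v = 0 := by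
  have := mulVec_dotProduct_self_of_skew hB (v := v) (μ := 0) (by simpa using h)
  rw [neg_zero, zero_mul] at this
  exact dotProduct_self_eq_zero.1 this

theorem mul_eq_zero_of_skew {B X : Matrix (Fin n) (Fin n) ℝ} (hB : Bᵀ = -B)
    (h : B * B * X = 0) : B * X = 0 := by
  refine Matrix.ext_iff_mulVec.2 fun v => ?_
  rw [← Matrix.mulVec_mulVec, mulVec_eq_zero_of_skew hB (by rw [Matrix.mulVec_mulVec, h]; simp)]
  simp

theorem exp_mulVec_of_skew {B : Matrix (Fin n) (Fin n) ℝ} (hB : Bᵀ = -B) {v : Fin n → ℝ} {θ : ℝ}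
    (h : (B * B) *ᵥ v = (-θ ^ 2) • v) :
    NormedSpace.exp B *ᵥ v = cos θ • v + (sin θ / θ) • (B *ᵥ v) := by
  refine exp_mulVec_of_sq_mulVec h fun h0 => mulVec_eq_zero_of_skew hB ?_
  rw [h, h0]; simp

end SkewMatrices

/-! ### Checking identities on eigenvectors of a symmetric matrix, and functional calculus by
polynomials. -/

section Symmetric

variable {n : ℕ} {S : Matrix (Fin n) (Fin n) ℝ}

/-- A vector orthogonal to all eigenvectors of a symmetric matrix vanishes. -/
theorem eq_zero_of_forall_eigenvector_dotProduct (hS : Sᵀ = S) {x : Fin n → ℝ}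
    (h : ∀ (c : ℝ) (v : Fin n → ℝ), v ≠ 0 → S *ᵥ v = c • v → v ⬝ᵥ x = 0) : x = 0 := by
  have hH : S.IsHermitian := by
    rw [Matrix.IsHermitian, Matrix.conjTranspose_eq_transpose_of_trivial, hS]
  let b := hH.eigenvectorBasis
  have : WithLp.toLp 2 x = (0 : EuclideanSpace ℝ (Fin n)) := by
    refine b.repr.injective ?_
    ext i
    rw [map_zero, b.repr_apply_apply]
    change _ = (0 : ℝ)
    have := h (hH.eigenvalues i) (b i).ofLp
      (fun h0 => b.toBasis.ne_zero i (by rw [b.coe_toBasis]; ext j; exact congrFun h0 j))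
      (hH.mulVec_eigenvectorBasis i)
    rw [← this, EuclideanSpace.inner_eq_star_dotProduct, dotProduct_comm]
    rfl
  simpa using this

/-- Two matrices agreeing on the eigenvectors of a symmetric matrix are equal. -/
theorem ext_of_eigenvectors (hS : Sᵀ = S) {m : ℕ} {X Y : Matrix (Fin m) (Fin n) ℝ}
    (h : ∀ (c : ℝ) (v : Fin n → ℝ), v ≠ 0 → S *ᵥ v = c • v → X *ᵥ v = Y *ᵥ v) : X = Y := by
  funext i
  refine sub_eq_zero.1 (eq_zero_of_forall_eigenvector_dotProduct hS fun c v hv hc => ?_)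
  rw [dotProduct_comm, sub_dotProduct, sub_eq_zero]
  exact congrFun (h c v hv hc) i

theorem aeval_mulVec {c : ℝ} {v : Fin n → ℝ} (h : S *ᵥ v = c • v) (p : Polynomial ℝ) :
    Polynomial.aeval S p *ᵥ v = p.eval c • v := by
  induction p using Polynomial.induction_on' with
  | add p q hp hq => simp [Matrix.add_mulVec, hp, hq, add_smul]
  | monomial k a =>
    have : S ^ k *ᵥ v = c ^ k • v := by
      induction k with
      | zero => simp
      | succ k ih => rw [pow_succ, ← Matrix.mulVec_mulVec, h, Matrix.mulVec_smul, ih, smul_smul,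
          pow_succ, mul_comm]
    rw [Polynomial.aeval_monomial, Polynomial.eval_monomial, ← Algebra.smul_def,
      Matrix.smul_mulVec, this, smul_smul]

/-- Any real function of a matrix is realised on its eigenvectors by a polynomial. -/
theorem exists_polynomial_eval_eq (S : Matrix (Fin n) (Fin n) ℝ) (f : ℝ → ℝ) :
    ∃ p : Polynomial ℝ, ∀ (c : ℝ) (v : Fin n → ℝ), S *ᵥ v = c • v →
      Polynomial.aeval S p *ᵥ v = f c • v := by
  classical
  have hfin := Module.End.finite_hasEigenvalue (Matrix.toLin' S)
  -- The spectrum is finite, so f can be interpolated on it.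
  refine ⟨Lagrange.interpolate hfin.toFinset id f, fun c v hc => ?_⟩
  rcases eq_or_ne v 0 with rfl | hv
  · simp
  have hev : Module.End.HasEigenvalue (Matrix.toLin' S) c :=
    Module.End.hasEigenvalue_of_hasEigenvector (x := v)
      ⟨Module.End.mem_eigenspace_iff.2 (by simpa using hc), hv⟩
  rw [aeval_mulVec hc]
  congr 1
  exact Lagrange.eval_interpolate_at_node (v := id) f Function.injective_id.injOn
    (hfin.mem_toFinset.2 hev)

theorem transpose_aeval (hS : Sᵀ = S) (p : Polynomial ℝ) :
    (Polynomial.aeval S p)ᵀ = Polynomial.aeval S p := by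
  induction p using Polynomial.induction_on' with
  | add p q hp hq => simp [hp, hq]
  | monomial k a =>
    rw [Polynomial.aeval_monomial, ← Algebra.smul_def, Matrix.transpose_smul,
      Matrix.transpose_pow, hS]

end Symmetric

/-! ### From real eigenvectors of the square to bounds on complex eigenvalues, and back. -/

section EigenvalueBounds

variable {n : ℕ}

theorem map_mulVec_ofReal (B : Matrix (Fin n) (Fin n) ℝ) (v : Fin n → ℝ) :
    B.map (algebraMap ℝ ℂ) *ᵥ (fun i => (v i : ℂ)) = fun i => ((B *ᵥ v) i : ℂ) := by
  funext i
  exact (RingHom.map_mulVec (algebraMap ℝ ℂ) B v i).symm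

theorem le_of_eigenvalue_bound {B : Matrix (Fin n) (Fin n) ℝ} {r : ℝ} (hr : 0 ≤ r)
    (hB : ∀ z : ℂ, Module.End.HasEigenvalue (Matrix.toLin' (B.map (algebraMap ℝ ℂ))) z → ‖z‖ ≤ r)
    {v : Fin n → ℝ} {θ : ℝ} (hv : v ≠ 0) (h : (B * B) *ᵥ v = (-θ ^ 2) • v) : θ ≤ r := by
  rcases eq_or_ne θ 0 with rfl | hθ
  · exact hr
  have key : Module.End.HasEigenvalue (Matrix.toLin' (B.map (algebraMap ℝ ℂ)))
      (θ * Complex.I) := by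
    -- Since (B - iθ)(B + iθ)v = (B² + θ²)v = 0, the vector Bv + iθv is an eigenvector for iθ; its
    -- imaginary part θv shows that it is nonzero.
    refine Module.End.hasEigenvalue_of_hasEigenvector
      (x := (fun i => ((B *ᵥ v) i : ℂ)) + (θ * Complex.I) • fun i => (v i : ℂ)) ⟨?_, ?_⟩
    · rw [Module.End.mem_eigenspace_iff, Matrix.toLin'_apply, Matrix.mulVec_add,
        Matrix.mulVec_smul, map_mulVec_ofReal, map_mulVec_ofReal, Matrix.mulVec_mulVec, h]
      funext i
      simp only [Pi.add_apply, Pi.smul_apply, smul_eq_mul]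
      push_cast
      linear_combination (-(θ : ℂ) ^ 2 * v i) * Complex.I_sq
    · intro h0
      obtain ⟨i, hi⟩ := Function.ne_iff.1 hv
      have := congrArg Complex.im (congrFun h0 i)
      simp [hθ] at this
      exact hi this
  calc θ ≤ |θ| := le_abs_self θ
    _ = ‖(θ * Complex.I : ℂ)‖ := by simp
    _ ≤ r := hB _ key

/-- Moving A² across the bilinear pairing of v with an eigenvector w for z gives (z² + θ²)⟨v, w⟩ =
0. If ‖z‖ > r, then w is orthogonal to every eigenvector v of S, so its real and imaginary parts
vanish. -/
theorem eigenvalue_bound_of_skew {A S : Matrix (Fin n) (Fin n) ℝ} {r : ℝ}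
    (hA : Aᵀ = -A) (hS : Sᵀ = S)
    (h : ∀ (c : ℝ) (v : Fin n → ℝ), v ≠ 0 → S *ᵥ v = c • v →
      ∃ θ : ℝ, |θ| ≤ r ∧ (A * A) *ᵥ v = (-θ ^ 2) • v)
    {z : ℂ} (hz : Module.End.HasEigenvalue (Matrix.toLin' (A.map (algebraMap ℝ ℂ))) z) :
    ‖z‖ ≤ r := by
  obtain ⟨w, hw⟩ := hz.exists_hasEigenvector
  have hzw : A.map (algebraMap ℝ ℂ) *ᵥ w = z • w := by
    simpa using Module.End.mem_eigenspace_iff.1 hw.1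
  by_contra hne
  refine hw.2 ?_
  have key : ∀ (c : ℝ) (v : Fin n → ℝ), v ≠ 0 → S *ᵥ v = c • v →
      (fun i => (v i : ℂ)) ⬝ᵥ w = 0 := by
    intro c v hv hc
    obtain ⟨θ, hθ, hv2⟩ := h c v hv hc
    have e1 : (fun i => (v i : ℂ)) ⬝ᵥ (A.map (algebraMap ℝ ℂ) *ᵥ (A.map (algebraMap ℝ ℂ) *ᵥ w))
        = z ^ 2 * ((fun i => (v i : ℂ)) ⬝ᵥ w) := by
      rw [hzw, Matrix.mulVec_smul, hzw, smul_smul, dotProduct_smul, smul_eq_mul, pow_two]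
    have ht : (A.map (algebraMap ℝ ℂ))ᵀ = -A.map (algebraMap ℝ ℂ) := by
      rw [← Matrix.transpose_map, hA]
      ext i j; simp
    have e2 : (fun i => (v i : ℂ)) ⬝ᵥ (A.map (algebraMap ℝ ℂ) *ᵥ (A.map (algebraMap ℝ ℂ) *ᵥ w))
        = -(θ : ℂ) ^ 2 * ((fun i => (v i : ℂ)) ⬝ᵥ w) := by
      rw [Matrix.dotProduct_mulVec, Matrix.dotProduct_mulVec, ← Matrix.mulVec_transpose,
        ← Matrix.mulVec_transpose, ht, Matrix.neg_mulVec, Matrix.neg_mulVec, Matrix.mulVec_neg,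
        neg_neg, map_mulVec_ofReal, map_mulVec_ofReal, Matrix.mulVec_mulVec, hv2]
      simp only [dotProduct, Finset.mul_sum]
      refine Finset.sum_congr rfl fun i _ => ?_
      simp only [Pi.smul_apply, smul_eq_mul]
      push_cast
      ring
    have e3 : (z ^ 2 + (θ : ℂ) ^ 2) * ((fun i => (v i : ℂ)) ⬝ᵥ w) = 0 := by
      linear_combination e2 - e1
    refine (mul_eq_zero.1 e3).resolve_left fun h0 => hne ?_
    have h1 : ‖z‖ ^ 2 = |θ| ^ 2 := by
      rw [← norm_pow, eq_neg_of_add_eq_zero_left h0, norm_neg, norm_pow, Complex.norm_real,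
        Real.norm_eq_abs]
    rw [(pow_left_inj₀ (norm_nonneg z) (abs_nonneg θ) two_ne_zero).1 h1]
    exact hθ
  have hre : (fun i => (w i).re) = 0 :=
    eq_zero_of_forall_eigenvector_dotProduct hS fun c v hv hc => by
      simpa [dotProduct] using congrArg Complex.re (key c v hv hc)
  have him : (fun i => (w i).im) = 0 :=
    eq_zero_of_forall_eigenvector_dotProduct hS fun c v hv hc => by
      simpa [dotProduct] using congrArg Complex.im (key c v hv hc)
  funext i
  exact Complex.ext (congrFun hre i) (congrFun him i)

end EigenvalueBounds

/-! ### Symmetric and skew parts of an orthogonal matrix. -/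

section OrthogonalMatrices

variable {n : ℕ} {R : Matrix (Fin n) (Fin n) ℝ}

/-- The symmetric part of a real matrix. -/
noncomputable def symPart (R : Matrix (Fin n) (Fin n) ℝ) : Matrix (Fin n) (Fin n) ℝ := (1 / 2 : ℝ) • (R + Rᵀ)

/-- The skew symmetric part of a real matrix. -/
noncomputable def skewPart (R : Matrix (Fin n) (Fin n) ℝ) : Matrix (Fin n) (Fin n) ℝ := (1 / 2 : ℝ) • (R - Rᵀ)

theorem transpose_symPart : (symPart R)ᵀ = symPart R := by
  simp [symPart, add_comm]

theorem transpose_skewPart : (skewPart R)ᵀ = -skewPart R := by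
  rw [skewPart, Matrix.transpose_smul, Matrix.transpose_sub, Matrix.transpose_transpose, ← smul_neg,
    neg_sub]

theorem symPart_add_skewPart : symPart R + skewPart R = R := by
  rw [symPart, skewPart, ← smul_add, add_add_sub_cancel, ← two_smul ℝ R, smul_smul]
  norm_num

theorem symPart_mul_skewPart (hR : R * Rᵀ = 1) (hR' : Rᵀ * R = 1) :
    symPart R * skewPart R = skewPart R * symPart R := by
  simp only [symPart, skewPart, smul_mul_smul_comm]
  congr 1
  rw [add_mul, mul_sub, mul_sub, sub_mul, mul_add, mul_add, hR, hR']
  abel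

theorem skewPart_mul_skewPart (hR : R * Rᵀ = 1) (hR' : Rᵀ * R = 1) :
    skewPart R * skewPart R = symPart R * symPart R - 1 := by
  simp only [symPart, skewPart, smul_mul_smul_comm]
  have : (1 : Matrix (Fin n) (Fin n) ℝ) = (1 / 2 * (1 / 2) : ℝ) • (4 : ℝ) • 1 := by
    rw [smul_smul]; norm_num
  rw [this, ← smul_sub]
  congr 1
  have h4 : (4 : ℝ) • (1 : Matrix (Fin n) (Fin n) ℝ) = 1 + 1 + 1 + 1 := by
    module
  rw [sub_mul, mul_sub, mul_sub, add_mul, mul_add, mul_add, hR, hR', h4]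
  abel

theorem skewPart_sq_mulVec (hR : R * Rᵀ = 1) (hR' : Rᵀ * R = 1) {c : ℝ} {v : Fin n → ℝ}
    (hc : symPart R *ᵥ v = c • v) :
    (skewPart R * skewPart R) *ᵥ v = (c ^ 2 - 1) • v := by
  rw [skewPart_mul_skewPart hR hR', Matrix.sub_mulVec, ← Matrix.mulVec_mulVec, hc,
    Matrix.mulVec_smul, hc, smul_smul, Matrix.one_mulVec, sub_smul, one_smul, pow_two]

end OrthogonalMatrices

/-! ### The part of a principal logarithm that R determines. -/

section LogSplitting

variable {n : ℕ} {R P L : Matrix (Fin n) (Fin n) ℝ}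

/-- `P` is the orthogonal projection onto the eigenspace of the orthogonal matrix `R` for `-1`, and
`L` is the part common to all skew symmetric principal logarithms of `R`. -/
structure IsLogSplitting (R P L : Matrix (Fin n) (Fin n) ℝ) : Prop where
  transpose_proj : Pᵀ = P
  proj_mulVec : ∀ v, R *ᵥ v = -v → P *ᵥ v = v
  mul_proj : R * P = -P
  transpose_log : Lᵀ = -L
  log_mul_proj : L * P = 0
  exp_log : NormedSpace.exp L = R + (2 : ℝ) • P
  sq_log : ∀ (c : ℝ) (v : Fin n → ℝ), v ≠ 0 → symPart R *ᵥ v = c • v →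
    (L * L) *ᵥ v = (-arccos c ^ 2) • v + (π ^ 2) • (P *ᵥ v)
  commute : ∀ B : SkewMatrix n, B ∈ Aplog R →
    P * (B : Matrix (Fin n) (Fin n) ℝ) = (B : Matrix (Fin n) (Fin n) ℝ) * P
  sq_mul_proj : ∀ B : SkewMatrix n, B ∈ Aplog R →
    (B : Matrix (Fin n) (Fin n) ℝ) * (B : Matrix (Fin n) (Fin n) ℝ) * P = (-π ^ 2) • P
  eq_add : ∀ B : SkewMatrix n, B ∈ Aplog R →
    (B : Matrix (Fin n) (Fin n) ℝ) = L + (B : Matrix (Fin n) (Fin n) ℝ) * P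

/-- With K the skew part, |Kv|² = (1 - c²)|v|². The bound makes c the cosine of `arccos c`. -/
theorem abs_le_one_of_symPart_mulVec (hR : R * Rᵀ = 1) (hR' : Rᵀ * R = 1) {c : ℝ}
    {v : Fin n → ℝ} (hv : v ≠ 0) (hc : symPart R *ᵥ v = c • v) : -1 ≤ c ∧ c ≤ 1 := by
  have h := mulVec_dotProduct_self_of_skew transpose_skewPart (skewPart_sq_mulVec hR hR' hc)
  have h1 : 0 ≤ (skewPart R *ᵥ v) ⬝ᵥ (skewPart R *ᵥ v) := dotProduct_self_nonneg _
  have h2 : 0 < v ⬝ᵥ v :=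
    (dotProduct_self_nonneg v).lt_of_ne' (dotProduct_self_eq_zero.not.2 hv)
  have h3 : 0 ≤ -(c ^ 2 - 1) := nonneg_of_mul_nonneg_left (h ▸ h1) h2
  exact abs_le.1 ((sq_le_one_iff_abs_le_one c).1 (by linarith))

/-- A skew symmetric principal logarithm determines the symmetric and skew symmetric parts on its
own invariant planes. -/
theorem exists_angle_of_mem_Aplog {B : SkewMatrix n} (hB : B ∈ Aplog R) {μ : ℝ} {v : Fin n → ℝ}
    (hv : v ≠ 0)
    (h : ((B : Matrix (Fin n) (Fin n) ℝ) * (B : Matrix (Fin n) (Fin n) ℝ)) *ᵥ v = μ • v) :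
    ∃ θ, 0 ≤ θ ∧ θ ≤ π ∧ μ = -θ ^ 2 ∧ symPart R *ᵥ v = cos θ • v ∧
      symPart R *ᵥ ((B : Matrix (Fin n) (Fin n) ℝ) *ᵥ v) =
        cos θ • ((B : Matrix (Fin n) (Fin n) ℝ) *ᵥ v) ∧
      skewPart R *ᵥ v = (sin θ / θ) • ((B : Matrix (Fin n) (Fin n) ℝ) *ᵥ v) := by
  obtain ⟨hexp, hbd⟩ := hB
  have hsk := (transpose_coe_skewMatrix B)
  generalize (B : Matrix (Fin n) (Fin n) ℝ) = B at *
  have hμ : μ ≤ 0 := by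
    have h1 : 0 ≤ (B *ᵥ v) ⬝ᵥ (B *ᵥ v) := dotProduct_self_nonneg _
    have h2 : 0 < v ⬝ᵥ v :=
    (dotProduct_self_nonneg v).lt_of_ne' (dotProduct_self_eq_zero.not.2 hv)
    have h3 := nonneg_of_mul_nonneg_left (mulVec_dotProduct_self_of_skew hsk h ▸ h1) h2
    linarith
  obtain ⟨θ, hθ0, rfl⟩ : ∃ θ, 0 ≤ θ ∧ μ = -θ ^ 2 :=
    ⟨√(-μ), sqrt_nonneg _, by rw [sq_sqrt (by linarith)]; ring⟩
  -- Hence the symmetric and skew parts of R are the even and odd parts of the exponential of B.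
  have hexp' : NormedSpace.exp (-B) = Rᵀ := by rw [← hexp, ← Matrix.exp_transpose, hsk]
  have hneg : (-B)ᵀ = -(-B) := by rw [Matrix.transpose_neg, hsk]
  have both : ∀ w, (B * B) *ᵥ w = (-θ ^ 2) • w → symPart R *ᵥ w = cos θ • w ∧
      skewPart R *ᵥ w = (sin θ / θ) • (B *ᵥ w) := by
    intro w hw
    have e1 := exp_mulVec_of_skew hsk hw
    have e2 := exp_mulVec_of_skew (B := -B) hneg (v := w) (θ := θ) (by rw [neg_mul_neg, hw])
    rw [hexp] at e1
    rw [hexp', Matrix.neg_mulVec] at e2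
    constructor
    · rw [symPart, Matrix.smul_mulVec, Matrix.add_mulVec, e1, e2]
      module
    · rw [skewPart, Matrix.smul_mulVec, Matrix.sub_mulVec, e1, e2]
      module
  refine ⟨θ, hθ0, le_of_eigenvalue_bound pi_pos.le hbd hv h, rfl, (both v h).1,
    (both _ ?_).1, (both v h).2⟩
  rw [Matrix.mulVec_mulVec, mul_assoc, ← Matrix.mulVec_mulVec, h, Matrix.mulVec_smul]

theorem exists_isLogSplitting (hR : R * Rᵀ = 1) (hR' : Rᵀ * R = 1) :
    ∃ P L, IsLogSplitting R P L := by
  -- P is the spectral projection of S at -1, and L = KT with T the function θ/sin θ of S, θ =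
  -- arccos c. At c = ±1 the quotient defaults to 0, which is harmless because K kills those
  -- eigenvectors.
  obtain ⟨p, hp⟩ := exists_polynomial_eval_eq (symPart R) fun c => if c = -1 then 1 else 0
  obtain ⟨q, hq⟩ := exists_polynomial_eval_eq (symPart R) fun c => arccos c / sin (arccos c)
  have hPt := transpose_aeval (transpose_symPart (R := R)) p
  have hTt := transpose_aeval (transpose_symPart (R := R)) q
  generalize Polynomial.aeval (symPart R) p = P at *
  generalize Polynomial.aeval (symPart R) q = T at *
  have hSt := transpose_symPart (R := R)
  have hKt := transpose_skewPart (R := R)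
  have hSK := symPart_mul_skewPart hR hR'
  have hadd := symPart_add_skewPart (R := R)
  have hKK := fun {c v} => skewPart_sq_mulVec hR hR' (c := c) (v := v)
  have hle := fun {c v} => abs_le_one_of_symPart_mulVec hR hR' (c := c) (v := v)
  have hang := fun {B} hB {μ v} => exists_angle_of_mem_Aplog (R := R) (B := B) hB (μ := μ) (v := v)
  have hS0 : ∀ v, R *ᵥ v = -v → symPart R *ᵥ v = (-1 : ℝ) • v := by
    intro v hv
    have : Rᵀ *ᵥ v = -v := by
      rw [← neg_eq_iff_eq_neg, ← Matrix.mulVec_neg, ← hv, Matrix.mulVec_mulVec, hR',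
        Matrix.one_mulVec]
    rw [symPart, Matrix.smul_mulVec, Matrix.add_mulVec, this, hv]
    module
  generalize hSdef : symPart R = S at *
  generalize skewPart R = K at *
  have hK : ∀ {c : ℝ} {v}, S *ᵥ v = c • v → S *ᵥ (K *ᵥ v) = c • (K *ᵥ v) := by
    intro c v hc
    rw [Matrix.mulVec_mulVec, hSK, ← Matrix.mulVec_mulVec, hc, Matrix.mulVec_smul]
  have hK0 : ∀ {c : ℝ} {v}, S *ᵥ v = c • v → c ^ 2 = 1 → K *ᵥ v = 0 := by
    intro c v hc h1
    exact mulVec_eq_zero_of_skew hKt (by rw [hKK hc, h1]; simp)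
  have hL : ∀ {c : ℝ} {v}, S *ᵥ v = c • v →
      (K * T) *ᵥ v = (arccos c / sin (arccos c)) • (K *ᵥ v) := by
    intro c v hc
    rw [← Matrix.mulVec_mulVec, hq c v hc, Matrix.mulVec_smul]
  have hLL : ∀ {c : ℝ} {v}, v ≠ 0 → S *ᵥ v = c • v →
      ((K * T) * (K * T)) *ᵥ v = (if c = -1 then 0 else -arccos c ^ 2) • v := by
    intro c v hv hc
    rw [← Matrix.mulVec_mulVec, hL hc, Matrix.mulVec_smul, hL (hK hc), Matrix.mulVec_mulVec,
      hKK hc, smul_smul, smul_smul]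
    congr 1
    obtain ⟨h1, h2⟩ := hle hv hc
    have hs : c ^ 2 - 1 = -sin (arccos c) ^ 2 := by
      have := sin_sq_add_cos_sq (arccos c)
      rw [cos_arccos h1 h2] at this
      linarith
    split_ifs with h
    · subst h; simp
    · rcases eq_or_ne c 1 with rfl | h'
      · simp
      · have : sin (arccos c) ≠ 0 := (sin_pos_of_pos_of_lt_pi (arccos_pos.2 (lt_of_le_of_ne h2 h'))
          (lt_of_le_of_ne (arccos_le_pi c) fun h3 => h (by
            rw [← cos_arccos h1 h2, h3, cos_pi]))).ne'
        rw [hs]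
        field_simp
  have hRv : ∀ v, R *ᵥ v = S *ᵥ v + K *ᵥ v := fun v => by rw [← Matrix.add_mulVec, hadd]
  have hLt : (K * T)ᵀ = -(K * T) := by
    rw [Matrix.transpose_mul, hKt, hTt, mul_neg, neg_inj]
    refine ext_of_eigenvectors hSt fun c v _ hc => ?_
    rw [hL hc, ← Matrix.mulVec_mulVec, hq c _ (hK hc)]
  refine ⟨P, K * T, hPt, fun v hv => by simpa using hp (-1) v (hS0 v hv), ?_, hLt, ?_, ?_, ?_, ?_,
    ?_, ?_⟩
  · refine ext_of_eigenvectors hSt fun c v _ hc => ?_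
    rw [← Matrix.mulVec_mulVec, Matrix.neg_mulVec, hp c v hc]
    split_ifs with h
    · rw [one_smul, hRv, hc, hK0 hc (by rw [h]; norm_num), h]; simp
    · simp
  · refine ext_of_eigenvectors hSt fun c v _ hc => ?_
    rw [← Matrix.mulVec_mulVec, hp c v hc, Matrix.mulVec_smul, hL hc]
    split_ifs with h
    · rw [hK0 hc (by rw [h]; norm_num)]; simp
    · simp
  · refine ext_of_eigenvectors hSt fun c v hv hc => ?_
    -- At c = -1 the angle of L is 0 instead of π, so exp L is 1 there while R is -1; this is the
    -- source of the term 2P.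
    have h1 : ((K * T) * (K * T)) *ᵥ v = (-(if c = -1 then 0 else arccos c) ^ 2) • v := by
      rw [hLL hv hc]; split_ifs <;> simp
    obtain ⟨h2, h3⟩ := hle hv hc
    rw [exp_mulVec_of_skew hLt h1, hL hc, Matrix.add_mulVec, Matrix.smul_mulVec, hp c v hc, hRv, hc]
    split_ifs with h
    · rw [hK0 hc (by rw [h]; norm_num), h, cos_zero]; module
    · rw [cos_arccos h2 h3]
      rcases eq_or_ne c 1 with rfl | h'
      · simp [hK0 hc]
      · have h4 : sin (arccos c) ≠ 0 := (sin_pos_of_pos_of_lt_pi (arccos_pos.2 (lt_of_le_of_ne h3 h'))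
          (lt_of_le_of_ne (arccos_le_pi c) fun h3' => h (by
            rw [← cos_arccos h2 h3, h3', cos_pi]))).ne'
        have h5 : arccos c ≠ 0 := fun h0 => h4 (by rw [h0, sin_zero])
        rw [smul_smul, div_mul_div_cancel₀ h5, div_self h4]
        simp
  · intro c v hv hc
    rw [hSdef] at hc
    rw [hLL hv hc, hp c v hc]
    split_ifs with h
    · rw [h, arccos_neg_one]; module
    · simp
  · intro B hB
    -- The test vectors are now eigenvectors v of B²; both v and Bv lie in the same eigenspace of S,
    -- so P acts on them by the same scalar.
    refine ext_of_eigenvectors (S := (B : Matrix (Fin n) (Fin n) ℝ) * (B : Matrix (Fin n) (Fin n) ℝ))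
      (by simp [(transpose_coe_skewMatrix B)]) fun μ v hv hμ => ?_
    obtain ⟨θ, hθ0, hθ, -, h1, h2, h3⟩ := hang hB hv hμ
    rw [← Matrix.mulVec_mulVec, ← Matrix.mulVec_mulVec, hp _ _ h1, hp _ _ h2, Matrix.mulVec_smul]
  · intro B hB
    refine ext_of_eigenvectors (S := (B : Matrix (Fin n) (Fin n) ℝ) * (B : Matrix (Fin n) (Fin n) ℝ))
      (by simp [(transpose_coe_skewMatrix B)]) fun μ v hv hμ => ?_
    obtain ⟨θ, hθ0, hθ, rfl, h1, h2, h3⟩ := hang hB hv hμ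
    rw [← Matrix.mulVec_mulVec, Matrix.smul_mulVec, hp _ _ h1, Matrix.mulVec_smul, hμ]
    split_ifs with h
    · have : θ = π := by rw [← arccos_cos hθ0 hθ, h, arccos_neg_one]
      rw [this]; module
    · simp
  · intro B hB
    refine ext_of_eigenvectors (S := (B : Matrix (Fin n) (Fin n) ℝ) * (B : Matrix (Fin n) (Fin n) ℝ))
      (by simp [(transpose_coe_skewMatrix B)]) fun μ v hv hμ => ?_
    obtain ⟨θ, hθ0, hθ, rfl, h1, h2, h3⟩ := hang hB hv hμ
    rw [Matrix.add_mulVec, hL h1, ← Matrix.mulVec_mulVec, hp _ _ h1, Matrix.mulVec_smul, h3,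
      arccos_cos hθ0 hθ, smul_smul]
    split_ifs with h
    · have : θ = π := by rw [← arccos_cos hθ0 hθ, h, arccos_neg_one]
      simp [this]
    · rcases eq_or_ne θ 0 with rfl | h0
      · rw [mulVec_eq_zero_of_skew (transpose_coe_skewMatrix B) (by rw [hμ]; simp)]; simp
      · have h4 : sin θ ≠ 0 := (sin_pos_of_pos_of_lt_pi (lt_of_le_of_ne hθ0 h0.symm)
          (lt_of_le_of_ne hθ fun h5 => h (by rw [h5, cos_pi]))).ne'
        rw [div_mul_div_cancel₀ h4, div_self h0]
        simp

end LogSplitting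

/-! ### Logarithms as L + πW with W² = -P. -/

section Description

variable {n : ℕ} {R P L : Matrix (Fin n) (Fin n) ℝ}

/-- W²(1 - P) = 0, and one factor W cancels because W is skew. -/
theorem mul_proj_of_sq_eq_neg {W : Matrix (Fin n) (Fin n) ℝ} (hW : Wᵀ = -W) (hP : P * P = P)
    (h : W * W = -P) : W * P = W := by
  have := mul_eq_zero_of_skew hW (X := 1 - P) (by rw [h, mul_sub, mul_one, neg_mul, hP]; simp)
  rw [mul_sub, mul_one, sub_eq_zero] at this
  exact this.symm

theorem proj_mul_of_sq_eq_neg {W : Matrix (Fin n) (Fin n) ℝ} (hW : Wᵀ = -W) (hP : P * P = P)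
    (h : W * W = -P) : P * W = W := by
  have h1 := mul_proj_of_sq_eq_neg hW hP h
  rw [← neg_eq_iff_eq_neg.2 h, neg_mul, mul_assoc, h, mul_neg, h1, neg_neg]

/-- W rotates the range of P by a quarter turn and kills its kernel, so exp(πW) is cos π = -1 on the
range and 1 on the kernel. -/
theorem exp_pi_smul_of_sq_eq_neg {W : Matrix (Fin n) (Fin n) ℝ} (hW : Wᵀ = -W) (hPt : Pᵀ = P)
    (hP : P * P = P) (h : W * W = -P) : NormedSpace.exp (π • W) = 1 - (2 : ℝ) • P := by
  refine ext_of_eigenvectors hPt fun c v hv hc => ?_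
  have hc2 : c = 0 ∨ c = 1 := by
    have h1 : (c * c - c) • v = 0 := by
      rw [sub_smul, ← smul_smul, ← hc, ← Matrix.mulVec_smul, ← hc, Matrix.mulVec_mulVec, hP, sub_self]
    have h2 := (smul_eq_zero.1 h1).resolve_right hv
    rcases mul_eq_zero.1 (show c * (c - 1) = 0 by linear_combination h2) with h3 | h3
    · exact Or.inl h3
    · exact Or.inr (by linarith)
  have hsk : (π • W)ᵀ = -(π • W) := by rw [Matrix.transpose_smul, hW, smul_neg]
  have hsq : (π • W * (π • W)) *ᵥ v = (-(π * c) ^ 2) • v := by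
    have h2 : c * c = c := by rcases hc2 with rfl | rfl <;> norm_num
    rw [smul_mul_smul_comm, h, Matrix.smul_mulVec, Matrix.neg_mulVec, hc, smul_neg, smul_smul,
      ← neg_smul]
    congr 1
    linear_combination (π ^ 2) * h2
  rw [exp_mulVec_of_skew hsk hsq, Matrix.sub_mulVec, Matrix.one_mulVec, Matrix.smul_mulVec (2 : ℝ), hc]
  rcases hc2 with rfl | rfl
  · simp
  · simp only [mul_one, cos_pi, sin_pi, zero_div, zero_smul, add_zero, one_smul]
    module

namespace IsLogSplitting

theorem proj_mul_self (h : IsLogSplitting R P L) : P * P = P := by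
  refine Matrix.ext_iff_mulVec.2 fun v => ?_
  rw [← Matrix.mulVec_mulVec]
  exact h.proj_mulVec _ (by rw [Matrix.mulVec_mulVec, h.mul_proj, Matrix.neg_mulVec])

theorem proj_mul_of_mul_eq_neg (h : IsLogSplitting R P L) {m : ℕ} {X : Matrix (Fin n) (Fin m) ℝ}
    (hX : R * X = -X) : P * X = X := by
  refine Matrix.ext_iff_mulVec.2 fun v => ?_
  rw [← Matrix.mulVec_mulVec]
  exact h.proj_mulVec _ (by rw [Matrix.mulVec_mulVec, hX, Matrix.neg_mulVec])

theorem proj_mul (h : IsLogSplitting R P L) (hR : Rᵀ * R = 1) : P * R = -P := by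
  have h1 : Rᵀ * P = -P := by
    rw [← neg_eq_iff_eq_neg, ← mul_neg, ← h.mul_proj, ← mul_assoc, hR, one_mul]
  have := congrArg Matrix.transpose h1
  simpa [h.transpose_proj] using this

theorem proj_mul_log (h : IsLogSplitting R P L) : P * L = 0 := by
  have := congrArg Matrix.transpose h.log_mul_proj
  simpa [h.transpose_proj, h.transpose_log] using this

theorem mem_Aplog_of_sq_eq_neg (h : IsLogSplitting R P L) {B W : SkewMatrix n}
    (hW : (W : Matrix (Fin n) (Fin n) ℝ) * (W : Matrix (Fin n) (Fin n) ℝ) = -P)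
    (hB : (B : Matrix (Fin n) (Fin n) ℝ) = L + π • (W : Matrix (Fin n) (Fin n) ℝ)) :
    B ∈ Aplog R := by
  have hWt := transpose_coe_skewMatrix W
  have hBt := transpose_coe_skewMatrix B
  rw [Aplog, Set.mem_ofPred_eq]
  generalize (B : Matrix (Fin n) (Fin n) ℝ) = B at *
  generalize (W : Matrix (Fin n) (Fin n) ℝ) = W at *
  have hLW : L * W = 0 := by
    rw [← proj_mul_of_sq_eq_neg hWt h.proj_mul_self hW, ← mul_assoc, h.log_mul_proj, zero_mul]
  have hWL : W * L = 0 := by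
    rw [← mul_proj_of_sq_eq_neg hWt h.proj_mul_self hW, mul_assoc, h.proj_mul_log, mul_zero]
  subst hB
  constructor
  -- As LW = WL = 0, the exponential factors as (R + 2P)(1 - 2P) = R.
  · rw [Matrix.exp_add_of_commute, h.exp_log,
      exp_pi_smul_of_sq_eq_neg hWt h.transpose_proj h.proj_mul_self hW, add_mul, mul_sub, mul_sub,
      mul_one, mul_one, mul_smul_comm, smul_mul_smul_comm, h.mul_proj, h.proj_mul_self]
    · module
    · rw [commute_iff_eq, mul_smul_comm, smul_mul_assoc, hLW, hWL]
  · intro z hz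
    refine eigenvalue_bound_of_skew hBt transpose_symPart (S := symPart R) (fun c v hv hc => ?_) hz
    refine ⟨arccos c, by rw [abs_of_nonneg (arccos_nonneg c)]; exact arccos_le_pi c, ?_⟩
    rw [add_mul, mul_add, mul_add, mul_smul_comm, smul_mul_smul_comm, smul_mul_assoc, hLW, hWL, hW,
      smul_zero, add_zero, zero_add, Matrix.add_mulVec, h.sq_log c v hv hc, Matrix.smul_mulVec,
      Matrix.neg_mulVec]
    module

theorem sq_mul_proj_smul (h : IsLogSplitting R P L) {B : SkewMatrix n} (hB : B ∈ Aplog R) :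
    (π⁻¹ • ((B : Matrix (Fin n) (Fin n) ℝ) * P)) * (π⁻¹ • ((B : Matrix (Fin n) (Fin n) ℝ) * P))
      = -P := by
  rw [smul_mul_smul_comm, mul_assoc, ← mul_assoc P, h.commute B hB, mul_assoc _ P P,
    h.proj_mul_self, ← mul_assoc, h.sq_mul_proj B hB, smul_smul]
  have : π⁻¹ * π⁻¹ * -π ^ 2 = -1 := by
    have := pi_ne_zero
    field_simp
  rw [this, neg_one_smul]

/-- The skew symmetric principal logarithms are obtained from the skew symmetric square roots of
the negative of the projection. -/
theorem mem_Aplog_iff (h : IsLogSplitting R P L) {B : SkewMatrix n} :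
    B ∈ Aplog R ↔ ∃ W : SkewMatrix n,
      (W : Matrix (Fin n) (Fin n) ℝ) * (W : Matrix (Fin n) (Fin n) ℝ) = -P ∧
      (B : Matrix (Fin n) (Fin n) ℝ) = L + π • (W : Matrix (Fin n) (Fin n) ℝ) := by
  refine ⟨fun hB => ?_, fun ⟨W, hW, e⟩ => h.mem_Aplog_of_sq_eq_neg hW e⟩
  refine ⟨⟨π⁻¹ • ((B : Matrix (Fin n) (Fin n) ℝ) * P), ?_⟩, h.sq_mul_proj_smul hB, ?_⟩
  · rw [mem_skewMatrix, Matrix.transpose_smul, Matrix.transpose_mul, h.transpose_proj,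
      transpose_coe_skewMatrix, mul_neg, smul_neg, h.commute B hB]
  · rw [smul_smul, mul_inv_cancel₀ pi_ne_zero, one_smul]
    exact h.eq_add B hB

theorem proj_eq_zero (h : IsLogSplitting R P L)
    (hev : ¬ Module.End.HasEigenvalue (Matrix.toLin' R) (-1)) : P = 0 := by
  refine Matrix.ext_iff_mulVec.2 fun v => ?_
  rw [Matrix.zero_mulVec]
  by_contra hne
  refine hev (Module.End.hasEigenvalue_of_hasEigenvector (x := P *ᵥ v)
    ⟨Module.End.mem_eigenspace_iff.2 ?_, hne⟩)
  rw [Matrix.toLin'_apply, Matrix.mulVec_mulVec, h.mul_proj, Matrix.neg_mulVec, neg_one_smul]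

theorem proj_ne_zero (h : IsLogSplitting R P L)
    (hev : Module.End.HasEigenvalue (Matrix.toLin' R) (-1)) : P ≠ 0 := by
  rintro rfl
  obtain ⟨v, hv⟩ := hev.exists_hasEigenvector
  refine hv.2 ?_
  have := h.proj_mulVec v (by simpa using Module.End.mem_eigenspace_iff.1 hv.1)
  rw [← this, Matrix.zero_mulVec]

theorem existsUnique (h : IsLogSplitting R P L)
    (hev : ¬ Module.End.HasEigenvalue (Matrix.toLin' R) (-1)) :
    ∃! B : SkewMatrix n, B ∈ Aplog R := by
  have hP := h.proj_eq_zero hev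
  refine ⟨⟨L, h.transpose_log⟩, h.mem_Aplog_of_sq_eq_neg (W := 0) (by simp [hP]) (by simp), ?_⟩
  intro B hB
  have := h.eq_add B hB
  rw [hP, mul_zero, add_zero] at this
  exact Subtype.ext this

end IsLogSplitting

end Description

/-! ### The singular value decomposition of a logarithm. -/

section SingularValues

variable {n p : ℕ} {R P L : Matrix (Fin n) (Fin n) ℝ} {B : SkewMatrix n} {θ : Fin p → ℝ}
  {C : Fin p → SkewMatrix n}

theorem IsSVDSystem.update_iff (hC : IsSVDSystem C) {k : Fin p} {W : SkewMatrix n} :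
    IsSVDSystem (Function.update C k W) ↔ W ≠ 0 ∧
      (W : Matrix (Fin n) (Fin n) ℝ) ^ 3 = -(W : Matrix (Fin n) (Fin n) ℝ) ∧
      ∀ j, j ≠ k → (W : Matrix (Fin n) (Fin n) ℝ) * (C j : Matrix (Fin n) (Fin n) ℝ) = 0 := by
  constructor
  · intro h
    refine ⟨by simpa using h.ne_zero k, by simpa using h.cube k, fun j hj => ?_⟩
    simpa [hj] using h.mul_eq_zero k j hj.symm
  · rintro ⟨h0, h1, h2⟩
    have h3 : ∀ j, j ≠ k →
        (C j : Matrix (Fin n) (Fin n) ℝ) * (W : Matrix (Fin n) (Fin n) ℝ) = 0 := by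
      intro j hj
      have := congrArg Matrix.transpose (h2 j hj)
      simpa [transpose_coe_skewMatrix] using this
    refine ⟨fun j => ?_, fun j => ?_, fun i j hij => ?_⟩
    · rcases eq_or_ne j k with rfl | hj
      · simpa using h0
      · simpa [hj] using hC.ne_zero j
    · rcases eq_or_ne j k with rfl | hj
      · simpa using h1
      · simpa [hj] using hC.cube j
    · rcases eq_or_ne i k with rfl | hi
      · simpa [hij.symm] using h2 j hij.symm
      · rcases eq_or_ne j k with rfl | hj
        · simpa [hi] using h3 i hi
        · simpa [hi, hj] using hC.mul_eq_zero i j hij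

theorem IsSVD.coe_eq (h : IsSVD B θ C) :
    (B : Matrix (Fin n) (Fin n) ℝ) = ∑ j, θ j • (C j : Matrix (Fin n) (Fin n) ℝ) := by
  rw [h.sum_eq]; simp

theorem IsSVD.mul_system (h : IsSVD B θ C) (j : Fin p) :
    (B : Matrix (Fin n) (Fin n) ℝ) * (C j : Matrix (Fin n) (Fin n) ℝ) =
      θ j • ((C j : Matrix (Fin n) (Fin n) ℝ) * (C j : Matrix (Fin n) (Fin n) ℝ)) := by
  rw [h.coe_eq, Finset.sum_mul, Finset.sum_eq_single j]
  · rw [smul_mul_assoc]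
  · intro i _ hij
    rw [smul_mul_assoc, h.system.mul_eq_zero i j hij, smul_zero]
  · simp

theorem IsSVD.pos (h : IsSVD B θ C) (j : Fin p) : 0 < θ j := by
  have := (h.range_eq ▸ Set.mem_range_self j : θ j ∈ _)
  obtain ⟨h0, i, hi⟩ := this
  exact lt_of_le_of_ne (hi ▸ LinearMap.singularValues_nonneg _ i) h0.symm

theorem IsSVDSystem.cube' (hC : IsSVDSystem C) (j : Fin p) :
    (C j : Matrix (Fin n) (Fin n) ℝ) * (C j : Matrix (Fin n) (Fin n) ℝ) *
      (C j : Matrix (Fin n) (Fin n) ℝ) = -(C j : Matrix (Fin n) (Fin n) ℝ) := by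
  rw [← hC.cube j, pow_succ, pow_two]

theorem IsSVD.sq_mul_system (h : IsSVD B θ C) (j : Fin p) :
    (B : Matrix (Fin n) (Fin n) ℝ) * (B : Matrix (Fin n) (Fin n) ℝ) *
      (C j : Matrix (Fin n) (Fin n) ℝ) = (-θ j ^ 2) • (C j : Matrix (Fin n) (Fin n) ℝ) := by
  rw [mul_assoc, h.mul_system, mul_smul_comm, ← mul_assoc, h.mul_system, smul_mul_assoc,
    h.system.cube', smul_neg, smul_neg, smul_smul]
  module

/-- Evaluating C_j B² P from the left and from the right gives -θ_j² C_j P = -π² C_j P, and θ_j > 0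
excludes θ_j = -π. -/
theorem IsSVD.system_mul_proj (h : IsSVD B θ C) (hP : IsLogSplitting R P L) (hB : B ∈ Aplog R)
    {j : Fin p} (hj : θ j ≠ π) : (C j : Matrix (Fin n) (Fin n) ℝ) * P = 0 := by
  have h1 := congrArg Matrix.transpose (h.sq_mul_system j)
  simp only [Matrix.transpose_mul, Matrix.transpose_smul, transpose_coe_skewMatrix, mul_neg,
    neg_mul, neg_neg, smul_neg, neg_inj, ← mul_assoc] at h1
  have h2 := congrArg (fun X => (C j : Matrix (Fin n) (Fin n) ℝ) * X) (hP.sq_mul_proj B hB)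
  simp only [← mul_assoc, mul_smul_comm] at h2
  rw [h1, smul_mul_assoc, ← sub_eq_zero, ← sub_smul] at h2
  refine (smul_eq_zero.1 h2).resolve_left fun h3 => hj ?_
  exact (pow_left_inj₀ (h.pos j).le pi_pos.le two_ne_zero).1 (by linarith)

theorem IsSVD.exists_eq_pi (h : IsSVD B θ C) (hP : IsLogSplitting R P L) (hB : B ∈ Aplog R)
    (hP0 : P ≠ 0) : ∃ k, θ k = π := by
  by_contra! hne
  refine hP0 ?_
  have h1 : (B : Matrix (Fin n) (Fin n) ℝ) * P = 0 := by
    rw [h.coe_eq, Finset.sum_mul]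
    refine Finset.sum_eq_zero fun j _ => ?_
    rw [smul_mul_assoc, h.system_mul_proj hP hB (hne j), smul_zero]
  have h2 := hP.sq_mul_proj B hB
  rw [mul_assoc, h1, mul_zero] at h2
  exact (smul_eq_zero.1 h2.symm).resolve_left (neg_ne_zero.2 (pow_ne_zero 2 pi_ne_zero))

theorem IsSVD.mul_proj (h : IsSVD B θ C) (hP : IsLogSplitting R P L) (hB : B ∈ Aplog R)
    {k : Fin p} (hk : θ k = π) : (B : Matrix (Fin n) (Fin n) ℝ) * P =
      π • ((C k : Matrix (Fin n) (Fin n) ℝ) * P) := by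
  rw [h.coe_eq, Finset.sum_mul, Finset.sum_eq_single k]
  · rw [smul_mul_assoc, hk]
  · intro j _ hj
    rw [smul_mul_assoc, h.system_mul_proj hP hB (fun h1 => hj (h.injective (h1.trans hk.symm))),
      smul_zero]
  · simp

/-- The range of C_k lies in the eigenspace of B² for -π², where R = exp B acts as cos π = -1. -/
theorem IsSVD.proj_mul_system (h : IsSVD B θ C) (hP : IsLogSplitting R P L) (hB : B ∈ Aplog R)
    {k : Fin p} (hk : θ k = π) :
    P * (C k : Matrix (Fin n) (Fin n) ℝ) = (C k : Matrix (Fin n) (Fin n) ℝ) := by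
  refine hP.proj_mul_of_mul_eq_neg (Matrix.ext_iff_mulVec.2 fun v => ?_)
  rw [← hB.1, ← Matrix.mulVec_mulVec, exp_mulVec_of_skew (transpose_coe_skewMatrix B) (θ := π)]
  · simp [Matrix.neg_mulVec]
  · rw [Matrix.mulVec_mulVec, h.sq_mul_system, hk, Matrix.smul_mulVec]

theorem IsSVD.sq_system (h : IsSVD B θ C) (hP : IsLogSplitting R P L) (hB : B ∈ Aplog R)
    {k : Fin p} (hk : θ k = π) :
    (C k : Matrix (Fin n) (Fin n) ℝ) ^ 2 = -P := by
  have h1 := congrArg Matrix.transpose (h.proj_mul_system hP hB hk)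
  rw [Matrix.transpose_mul, transpose_coe_skewMatrix, hP.transpose_proj, neg_mul, neg_inj] at h1
  have h2 := hP.sq_mul_proj B hB
  rw [mul_assoc, h.mul_proj hP hB hk, h1, mul_smul_comm, h.mul_system, hk, smul_smul, neg_smul,
    ← smul_neg, ← pow_two, ← pow_two] at h2
  exact smul_right_injective _ (pow_ne_zero 2 pi_ne_zero) h2

/-- The skew symmetric principal logarithms in terms of the singular value decomposition of one of
them. -/
theorem IsSVD.aplog_eq (h : IsSVD B θ C) (hP : IsLogSplitting R P L) (hB : B ∈ Aplog R)
    (hP0 : P ≠ 0) {k : Fin p} (hk : θ k = π) :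
    Aplog R = {A : SkewMatrix n | ∃ W : SkewMatrix n,
      IsSVDSystem (Function.update C k W) ∧
      (W : Matrix (Fin n) (Fin n) ℝ) ^ 2 = (C k : Matrix (Fin n) (Fin n) ℝ) ^ 2 ∧
      A = π • W + ∑ j ∈ Finset.univ.erase k, θ j • C j} := by
  have hC2 := h.sq_system hP hB hk
  -- BP = πC_k, so L = B - BP is the sum of the remaining terms.
  have hrest : L = ((∑ j ∈ Finset.univ.erase k, θ j • C j : SkewMatrix n) :
      Matrix (Fin n) (Fin n) ℝ) := by
    have h1 := hP.eq_add B hB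
    have h2 := congrArg Matrix.transpose (h.proj_mul_system hP hB hk)
    rw [Matrix.transpose_mul, transpose_coe_skewMatrix, hP.transpose_proj, neg_mul, neg_inj] at h2
    rw [h.mul_proj hP hB hk, h2] at h1
    have h3 := congrArg (Subtype.val) h.sum_eq
    rw [← Finset.add_sum_erase _ _ (Finset.mem_univ k), hk, h1, Submodule.coe_add,
      Submodule.coe_smul, add_comm] at h3
    exact add_left_cancel h3
  ext A
  rw [hP.mem_Aplog_iff, Set.mem_ofPred_eq]
  refine exists_congr fun W => ?_
  have hA : (A : Matrix (Fin n) (Fin n) ℝ) = L + π • (W : Matrix (Fin n) (Fin n) ℝ) ↔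
      A = π • W + ∑ j ∈ Finset.univ.erase k, θ j • C j := by
    rw [hrest, add_comm, ← Submodule.coe_smul, ← Submodule.coe_add, Subtype.coe_inj]
  rw [hA, ← and_assoc, and_congr_left_iff]
  rintro -
  rw [hC2, pow_two]
  refine ⟨fun hW => ⟨h.system.update_iff.2 ⟨?_, ?_, fun j hj => ?_⟩, hW⟩, fun hW => hW.2⟩
  · rintro rfl
    exact hP0 (neg_eq_zero.1 (by rw [← hW]; simp))
  · rw [pow_succ, pow_two, hW, neg_mul, proj_mul_of_sq_eq_neg (transpose_coe_skewMatrix W)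
      hP.proj_mul_self hW]
  -- W C_j = W P C_j = -W C_k² C_j = 0.
  · rw [← mul_proj_of_sq_eq_neg (transpose_coe_skewMatrix W) hP.proj_mul_self hW, mul_assoc,
      ← neg_eq_iff_eq_neg.2 hC2, pow_two, neg_mul, mul_assoc, h.system.mul_eq_zero k j hj.symm]
    simp

end SingularValues

/-! ### Multiplicity of -1, and parametrisation by skew orthogonal matrices. -/

section Frame

variable {n : ℕ} {R P L : Matrix (Fin n) (Fin n) ℝ}

namespace IsLogSplitting

theorem exists_frame (h : IsLogSplitting R P L) :
    ∃ U : Matrix (Fin n) (Fin (Module.finrank ℝ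
      (Module.End.eigenspace (Matrix.toLin' R) (-1)))) ℝ, Uᵀ * U = 1 ∧ U * Uᵀ = P := by
  let F := (Module.End.eigenspace (Matrix.toLin' R) (-1)).map
    (WithLp.linearEquiv 2 ℝ (Fin n → ℝ)).symm.toLinearMap
  have hF : Module.finrank ℝ F = Module.finrank ℝ
      (Module.End.eigenspace (Matrix.toLin' R) (-1)) := LinearEquiv.finrank_map_eq _ _
  have hmem : ∀ x : EuclideanSpace ℝ (Fin n), x ∈ F ↔ R *ᵥ x.ofLp = -x.ofLp := by
    intro x
    rw [Submodule.mem_map]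
    constructor
    · rintro ⟨y, hy, rfl⟩
      simpa using Module.End.mem_eigenspace_iff.1 hy
    · intro hx
      exact ⟨x.ofLp, Module.End.mem_eigenspace_iff.2 (by simpa using hx), rfl⟩
  let b := (stdOrthonormalBasis ℝ F).reindex (finCongr hF)
  have hin : ∀ x y : EuclideanSpace ℝ (Fin n), inner ℝ x y = ∑ a, x.ofLp a * y.ofLp a := by
    intro x y
    rw [PiLp.inner_apply]
    refine Finset.sum_congr rfl fun a _ => ?_
    simp [mul_comm]
  let U : Matrix (Fin n) (Fin (Module.finrank ℝ
      (Module.End.eigenspace (Matrix.toLin' R) (-1)))) ℝ :=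
    Matrix.of fun a j => (b j : EuclideanSpace ℝ (Fin n)).ofLp a
  have h1 : Uᵀ * U = 1 := by
    ext i j
    rw [Matrix.mul_apply, Matrix.one_apply, ← orthonormal_iff_ite.1 b.orthonormal i j,
      Submodule.coe_inner, hin]
    rfl
  have h2 : ∀ v, R *ᵥ v = -v → U *ᵥ (Uᵀ *ᵥ v) = v := by
    intro v hv
    have hx := b.sum_repr' ⟨WithLp.toLp 2 v, (hmem _).2 hv⟩
    funext a
    have := congrArg (fun y : F => (y : EuclideanSpace ℝ (Fin n)).ofLp a) hx
    simp only [Submodule.coe_sum, Submodule.coe_smul, WithLp.ofLp_sum, Finset.sum_apply,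
      WithLp.ofLp_smul, Pi.smul_apply, smul_eq_mul, Submodule.coe_inner, hin] at this
    rw [← this, Matrix.mulVec, dotProduct]
    refine Finset.sum_congr rfl fun j _ => ?_
    rw [mul_comm]
    rfl
  have h3 : P * U = U := by
    refine h.proj_mul_of_mul_eq_neg ?_
    ext a j
    exact congrFun ((hmem _).1 (b j).2) a
  -- UUᵀ fixes the range of P; transposing this and using PU = U gives UUᵀ = P.
  have h4 : U * Uᵀ * P = P := by
    refine Matrix.ext_iff_mulVec.2 fun v => ?_
    rw [← Matrix.mulVec_mulVec, ← Matrix.mulVec_mulVec]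
    exact h2 _ (by rw [Matrix.mulVec_mulVec, h.mul_proj, Matrix.neg_mulVec])
  refine ⟨U, h1, ?_⟩
  have h5 := congrArg Matrix.transpose h4
  rw [Matrix.transpose_mul, Matrix.transpose_mul, Matrix.transpose_transpose, h.transpose_proj,
    ← Matrix.mul_assoc, h3] at h5
  exact h5

/-- The algebraic multiplicity is the dimension of the generalised eigenspace. P fixes the kernel of
R + 1 while P(R + 1) = 0, so kernel and range meet only in 0 and no Jordan chain has length two. -/
theorem rootMultiplicity_charpoly (h : IsLogSplitting R P L) (hR : Rᵀ * R = 1) :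
    R.charpoly.rootMultiplicity (-1) =
      Module.finrank ℝ (Module.End.eigenspace (Matrix.toLin' R) (-1)) := by
  rw [← Matrix.charpoly_toLin', ← LinearMap.finrank_maxGenEigenspace_eq]
  have key : ∀ (k : ℕ) (v : Fin n → ℝ), (R + 1) ^ k *ᵥ v = 0 → (R + 1) *ᵥ v = 0 := by
    intro k
    induction k with
    | zero => intro v hv; rw [show v = 0 by simpa using hv, Matrix.mulVec_zero]
    | succ k ih =>
      intro v hv
      rcases k with _ | k
      · simpa using hv
      refine ih v ?_
      rw [pow_succ', ← Matrix.mulVec_mulVec, Matrix.add_mulVec, Matrix.one_mulVec] at hv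
      have h1 : P *ᵥ ((R + 1) ^ (k + 1) *ᵥ v) = (R + 1) ^ (k + 1) *ᵥ v := by
        exact h.proj_mulVec _ (eq_neg_of_add_eq_zero_left hv)
      rw [← h1, Matrix.mulVec_mulVec, pow_succ', ← mul_assoc, mul_add, h.proj_mul hR]
      simp
  suffices e : Module.End.maxGenEigenspace (Matrix.toLin' R) (-1) =
      Module.End.eigenspace (Matrix.toLin' R) (-1) by rw [e]
  refine le_antisymm (fun v hv => ?_) Module.End.eigenspace_le_maxGenEigenspace
  obtain ⟨k, hk⟩ := (Module.End.mem_maxGenEigenspace _ _ _).1 hv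
  have e : Matrix.toLin' R - (-1 : ℝ) • 1 = Matrix.toLin' (R + 1) := by
    ext; simp
  rw [e, ← Matrix.toLin'_pow, Matrix.toLin'_apply] at hk
  have := key k v hk
  rw [Module.End.mem_eigenspace_iff, Matrix.toLin'_apply, neg_one_smul]
  exact eq_neg_of_add_eq_zero_left (by simpa [Matrix.add_mulVec] using this)

/-- Take determinants in R = exp(L)(1 - 2UUᵀ): the first factor is the square of exp(L/2), the
second has determinant (-1)^m. -/
theorem even_of_frame (h : IsLogSplitting R P L) (hdet : R.det = 1) {m : ℕ}
    {U : Matrix (Fin n) (Fin m) ℝ} (hU : Uᵀ * U = 1) (hU' : U * Uᵀ = P) : Even m := by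
  have h1 : (NormedSpace.exp L).det * (1 - ((2 : ℝ) • U) * Uᵀ).det = 1 := by
    rw [← Matrix.det_mul, ← hdet, h.exp_log, Matrix.smul_mul, hU']
    congr 1
    rw [add_mul, mul_sub, mul_sub, mul_one, mul_one, mul_smul_comm, h.mul_proj,
      smul_mul_smul_comm, h.proj_mul_self]
    module
  have h2 : (1 - ((2 : ℝ) • U) * Uᵀ).det = (-1) ^ m := by
    rw [Matrix.det_one_sub_mul_comm, Matrix.mul_smul, hU]
    have : (1 - (2 : ℝ) • 1 : Matrix (Fin m) (Fin m) ℝ) = -1 := by module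
    rw [this, Matrix.det_neg, Matrix.det_one, Fintype.card_fin, mul_one]
  have h3 : 0 ≤ (NormedSpace.exp L).det := by
    have e : L = (1 / 2 : ℝ) • L + (1 / 2 : ℝ) • L := by module
    rw [e, Matrix.exp_add_of_commute _ _ (Commute.refl _), Matrix.det_mul]
    exact mul_self_nonneg _
  by_contra hodd
  rw [h2, (Nat.not_even_iff_odd.1 hodd).neg_one_pow] at h1
  linarith

end IsLogSplitting

/-- Congruence by a matrix `U`, as a linear map between spaces of skew symmetric matrices. -/
def skewCongr {m : ℕ} (U : Matrix (Fin n) (Fin m) ℝ) : SkewMatrix m →ₗ[ℝ] SkewMatrix n where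
  toFun M := ⟨U * (M : Matrix (Fin m) (Fin m) ℝ) * Uᵀ, by
    rw [mem_skewMatrix, Matrix.transpose_mul, Matrix.transpose_mul, transpose_coe_skewMatrix,
      Matrix.transpose_transpose, Matrix.neg_mul, Matrix.mul_neg, Matrix.mul_assoc]⟩
  map_add' M N := by ext1; simp [Matrix.mul_add, Matrix.add_mul]
  map_smul' c M := by ext1; simp

@[simp]
theorem coe_skewCongr {m : ℕ} (U : Matrix (Fin n) (Fin m) ℝ) (M : SkewMatrix m) :
    (skewCongr U M : Matrix (Fin n) (Fin n) ℝ) = U * (M : Matrix (Fin m) (Fin m) ℝ) * Uᵀ := rfl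

theorem mem_skewOrthogonal_iff {k : ℕ} {M : SkewMatrix k} : M ∈ SkewOrthogonal k ↔
    (M : Matrix (Fin k) (Fin k) ℝ) * (M : Matrix (Fin k) (Fin k) ℝ) = -1 := by
  rw [SkewOrthogonal, Set.mem_ofPred_eq, Matrix.mem_orthogonalGroup_iff,
        transpose_coe_skewMatrix, mul_neg, neg_eq_iff_eq_neg]

theorem skewCongr_skewCongr_of_mul_eq_one {m : ℕ} {U : Matrix (Fin n) (Fin m) ℝ}
    {V : Matrix (Fin m) (Fin n) ℝ} (h : V * U = 1) (M : SkewMatrix m) :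
    skewCongr V (skewCongr U M) = M := by
  ext1
  rw [coe_skewCongr, coe_skewCongr, ← Matrix.mul_assoc, ← Matrix.mul_assoc, h, Matrix.mul_assoc,
    ← Matrix.transpose_mul, h, Matrix.one_mul, Matrix.transpose_one, Matrix.mul_one]

/-- M ↦ UMUᵀ and W ↦ UᵀWU are inverse to each other between M² = -1 and W² = -P, because W = PW =
WP. -/
theorem IsLogSplitting.aplog_eq_image (h : IsLogSplitting R P L) {m : ℕ}
    {U : Matrix (Fin n) (Fin m) ℝ} (hU : Uᵀ * U = 1) (hU' : U * Uᵀ = P) :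
    Aplog R = (fun M => (⟨L, h.transpose_log⟩ : SkewMatrix n) + (π • skewCongr U) M) ''
      SkewOrthogonal m := by
  ext B
  rw [h.mem_Aplog_iff, Set.mem_image]
  constructor
  · rintro ⟨W, hW, hB⟩
    have hWt := transpose_coe_skewMatrix W
    have hWP := mul_proj_of_sq_eq_neg hWt h.proj_mul_self hW
    have hPW := proj_mul_of_sq_eq_neg hWt h.proj_mul_self hW
    refine ⟨skewCongr Uᵀ W, ?_, ?_⟩
    · rw [mem_skewOrthogonal_iff, coe_skewCongr, Matrix.transpose_transpose]
      calc Uᵀ * (W : Matrix (Fin n) (Fin n) ℝ) * U * (Uᵀ * (W : Matrix (Fin n) (Fin n) ℝ) * U)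
          = Uᵀ * ((W : Matrix (Fin n) (Fin n) ℝ) * (U * Uᵀ) * (W : Matrix (Fin n) (Fin n) ℝ)) * U := by
            simp only [Matrix.mul_assoc]
        _ = -(Uᵀ * (U * Uᵀ) * U) := by
            rw [hU', hWP, hW, Matrix.mul_neg, Matrix.neg_mul]
        _ = -1 := by rw [← Matrix.mul_assoc, hU, Matrix.one_mul, hU]
    · ext1
      rw [hB, LinearMap.smul_apply, Submodule.coe_add, Submodule.coe_smul, coe_skewCongr,
        coe_skewCongr, Matrix.transpose_transpose, ← Matrix.mul_assoc, ← Matrix.mul_assoc, hU',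
        Matrix.mul_assoc, hU', hPW, hWP]
  · rintro ⟨M, hM, rfl⟩
    rw [mem_skewOrthogonal_iff] at hM
    refine ⟨skewCongr U M, ?_, rfl⟩
    rw [coe_skewCongr, ← hU']
    calc U * (M : Matrix (Fin m) (Fin m) ℝ) * Uᵀ * (U * (M : Matrix (Fin m) (Fin m) ℝ) * Uᵀ)
        = U * ((M : Matrix (Fin m) (Fin m) ℝ) * (Uᵀ * U) * (M : Matrix (Fin m) (Fin m) ℝ)) * Uᵀ := by
          simp only [Matrix.mul_assoc]
      _ = -(U * Uᵀ) := by
          rw [hU, Matrix.mul_one, hM, Matrix.mul_neg, Matrix.neg_mul, Matrix.mul_one]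

end Frame

/-! ### Affine images of embedded submanifolds. -/

section Submanifolds

variable {E F : Type*} [NormedAddCommGroup E] [NormedSpace ℝ E] [FiniteDimensional ℝ E]
  [NormedAddCommGroup F] [NormedSpace ℝ F] [FiniteDimensional ℝ F]

/-- The image of an embedded submanifold under an injective affine map is an embedded
submanifold. -/
theorem IsEmbeddedSubmanifold.affine_image {S : Set E} (hS : IsEmbeddedSubmanifold S) (c : F)
    (i : E →ₗ[ℝ] F) (r : F →ₗ[ℝ] E) (hri : ∀ x, r (i x) = x) :
    IsEmbeddedSubmanifold ((fun x => c + i x) '' S) := by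
  obtain ⟨d, hd⟩ := hS
  refine ⟨d, ?_⟩
  rintro _ ⟨x, hx, rfl⟩
  obtain ⟨φ, V, hxs, hφ, hφ', hV, him⟩ := hd x hx
  have hi : ContDiff ℝ ∞ i := i.toContinuousLinearMap.contDiff
  have hr : ContDiff ℝ ∞ r := r.toContinuousLinearMap.contDiff
  have hrc : ContDiff ℝ ∞ fun y : F => r (y - c) := hr.comp (contDiff_id.sub contDiff_const)
  -- The retraction r splits F as i(E) ⊕ ker r; after translating by -c, the chart is φ on the first
  -- summand and the identity on the second.
  let Φ : F → F := fun y => i (φ (r (y - c))) + (y - c - i (r (y - c)))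
  let Ψ : F → F := fun z => c + (i (φ.symm (r z)) + (z - i (r z)))
  have hΦr : ∀ y, r (Φ y) = φ (r (y - c)) := fun y => by
    simp only [Φ, map_add, map_sub, hri]; abel
  have hΨr : ∀ z, r (Ψ z - c) = φ.symm (r z) := fun z => by
    simp only [Ψ, add_sub_cancel_left, map_add, map_sub, hri]; abel
  have hΦs : ContDiffOn ℝ ∞ Φ {y | r (y - c) ∈ φ.source} :=
    (hi.comp_contDiffOn (hφ.comp hrc.contDiffOn fun y hy => hy)).add
      (((contDiff_id.sub contDiff_const).sub (hi.comp hrc)).contDiffOn)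
  have hΨs : ContDiffOn ℝ ∞ Ψ {z | r z ∈ φ.target} :=
    contDiffOn_const.add ((hi.comp_contDiffOn (hφ'.comp hr.contDiffOn fun y hy => hy)).add
      ((contDiff_id.sub (hi.comp hr)).contDiffOn))
  let χ : OpenPartialHomeomorph F F :=
    { toFun := Φ
      invFun := Ψ
      source := {y | r (y - c) ∈ φ.source}
      target := {z | r z ∈ φ.target}
      map_source' := fun y hy => by
        rw [Set.mem_ofPred_eq, hΦr]; exact φ.map_source hy
      map_target' := fun z hz => by
        rw [Set.mem_ofPred_eq, hΨr]; exact φ.map_target hz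
      left_inv' := fun y hy => by
        change c + (i (φ.symm (r (Φ y))) + (Φ y - i (r (Φ y)))) = y
        rw [hΦr, φ.left_inv hy]
        simp only [Φ]
        abel
      right_inv' := fun z hz => by
        change i (φ (r (Ψ z - c))) + (Ψ z - c - i (r (Ψ z - c))) = z
        rw [hΨr, φ.right_inv hz]
        simp only [Ψ]
        abel
      open_source := φ.open_source.preimage hrc.continuous
      open_target := φ.open_target.preimage hr.continuous
      continuousOn_toFun := hΦs.continuousOn
      continuousOn_invFun := hΨs.continuousOn }
  have hinj : Function.Injective i := Function.LeftInverse.injective hri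
  refine ⟨χ, V.map i, ?_, hΦs, hΨs, ?_, ?_⟩
  · change r (c + i x - c) ∈ φ.source
    rwa [add_sub_cancel_left, hri]
  · rw [← hV]
    exact (Submodule.equivMapOfInjective i hinj V).finrank_eq.symm
  · ext z
    constructor
    · rintro ⟨_, ⟨hy, ⟨s, hs, rfl⟩⟩, rfl⟩
      refine ⟨χ.map_source hy, ?_⟩
      change r (c + i s - c) ∈ φ.source at hy
      rw [add_sub_cancel_left, hri] at hy
      have hz : χ (c + i s) = i (φ s) := by
        change Φ (c + i s) = _
        simp only [Φ, add_sub_cancel_left, hri, sub_self, add_zero]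
      change χ (c + i s) ∈ V.map i
      rw [hz]
      have := him ▸ Set.mem_image_of_mem φ (⟨hy, hs⟩ : s ∈ φ.source ∩ S)
      exact ⟨_, this.2, rfl⟩
    · rintro ⟨hz, w, hw, rfl⟩
      change r (i w) ∈ φ.target at hz
      rw [hri] at hz
      obtain ⟨s, ⟨hs1, hs2⟩, rfl⟩ : w ∈ φ '' (φ.source ∩ S) := him ▸ ⟨hz, hw⟩
      refine ⟨c + i s, ⟨?_, s, hs2, rfl⟩, ?_⟩
      · change r (c + i s - c) ∈ φ.source
        rwa [add_sub_cancel_left, hri]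
      · change Φ (c + i s) = _
        simp only [Φ, add_sub_cancel_left, hri, sub_self, add_zero]

theorem areDiffeomorphic_affine_image (S : Set E) (c : F) (i : E →ₗ[ℝ] F) (r : F →ₗ[ℝ] E)
    (hri : ∀ x, r (i x) = x) : AreDiffeomorphic ((fun x => c + i x) '' S) S := by
  have hleft : ∀ x, r (c + i x - c) = x := fun x => by rw [add_sub_cancel_left, hri]
  refine ⟨{ toFun := fun y => ⟨r (y - c), ?_⟩
            invFun := fun x => ⟨c + i x, Set.mem_image_of_mem _ x.2⟩
            left_inv := ?_
            right_inv := fun x => Subtype.ext (hleft x) }, fun y => ?_, fun x => ?_⟩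
  · obtain ⟨_, s, hs, rfl⟩ := y
    simpa only [hleft] using hs
  · rintro ⟨_, s, hs, rfl⟩
    exact Subtype.ext (by simp only [hleft])
  · exact ⟨Set.univ, fun y => r (y - c), isOpen_univ, Set.mem_univ _,
      (r.toContinuousLinearMap.contDiff.comp (contDiff_id.sub contDiff_const)).contDiffOn,
      fun y _ => rfl⟩
  · exact ⟨Set.univ, fun x => c + i x, isOpen_univ, Set.mem_univ _,
      (contDiff_const.add i.toContinuousLinearMap.contDiff).contDiffOn, fun y _ => rfl⟩

end Submanifolds

/-! ### Similarity of complex structures. -/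

section Similarity

theorem exists_linearEquiv_complex {V V' : Type*} [AddCommGroup V] [AddCommGroup V'] [Module ℝ V]
    [Module ℝ V'] [Module ℂ V] [Module ℂ V'] [IsScalarTower ℝ ℂ V] [IsScalarTower ℝ ℂ V']
    [FiniteDimensional ℝ V] [FiniteDimensional ℝ V']
    (h : Module.finrank ℝ V = Module.finrank ℝ V') :
    ∃ e : V ≃ₗ[ℝ] V', ∀ v, e (Complex.I • v) = Complex.I • e v := by
  have : FiniteDimensional ℂ V := Module.Finite.of_restrictScalars_finite ℝ ℂ V
  have : FiniteDimensional ℂ V' := Module.Finite.of_restrictScalars_finite ℝ ℂ V'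
  rw [← Module.finrank_mul_finrank ℝ ℂ V, ← Module.finrank_mul_finrank ℝ ℂ V',
    Complex.finrank_real_complex] at h
  let e := LinearEquiv.ofFinrankEq V V' (show Module.finrank ℂ V = Module.finrank ℂ V' by omega)
  exact ⟨e.restrictScalars ℝ, fun v => e.map_smul _ _⟩

theorem exists_linearEquiv_of_sq_eq_neg_one {V : Type*} [AddCommGroup V] [Module ℝ V]
    [FiniteDimensional ℝ V] {J J' : Module.End ℝ V} (hJ : J * J = -1) (hJ' : J' * J' = -1) :
    ∃ e : V ≃ₗ[ℝ] V, ∀ v, e (J v) = J' (e v) := by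
  -- Each K with K² = -1 makes V a complex space in which i acts as K. Two such structures on the
  -- same V have equal complex dimension, and a complex-linear isomorphism between them intertwines
  -- J and J'.
  let m : ∀ K : Module.End ℝ V, K * K = -1 → Module ℂ V := fun K hK =>
    Module.compHom V (Complex.liftAux K hK).toRingHom
  have hI : ∀ (K : Module.End ℝ V) (hK : K * K = -1) (v : V),
      (m K hK).toSMul.smul Complex.I v = K v := fun K hK v =>
    congrArg (fun f : Module.End ℝ V => f v) (Complex.liftAux_apply_I K hK)
  have ht : ∀ (K : Module.End ℝ V) (hK : K * K = -1),
      @IsScalarTower ℝ ℂ V _ (m K hK).toSMul _ := fun K hK =>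
    @IsScalarTower.mk ℝ ℂ V _ (m K hK).toSMul _ fun a z v =>
      congrArg (fun f : Module.End ℝ V => f v) (map_smul (Complex.liftAux K hK) a z)
  obtain ⟨e, he⟩ := @exists_linearEquiv_complex V V _ _ _ _ (m J hJ) (m J' hJ') (ht J hJ)
    (ht J' hJ') _ _ rfl
  refine ⟨e, fun v => ?_⟩
  rw [← hI J hJ, ← hI J' hJ']
  exact he v

theorem exists_isUnit_det_mul_eq {k : ℕ} {J J' : Matrix (Fin k) (Fin k) ℝ} (hJ : J * J = -1)
    (hJ' : J' * J' = -1) : ∃ P : Matrix (Fin k) (Fin k) ℝ, IsUnit P.det ∧ J' * P = P * J := by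
  have conv : ∀ {K : Matrix (Fin k) (Fin k) ℝ}, K * K = -1 →
      (Matrix.toLin' K : Module.End ℝ _) * Matrix.toLin' K = -1 := by
    intro K hK
    rw [Module.End.mul_eq_comp, ← Matrix.toLin'_mul, hK, map_neg, Matrix.toLin'_one]
    rfl
  obtain ⟨e, he⟩ := exists_linearEquiv_of_sq_eq_neg_one (conv hJ) (conv hJ')
  refine ⟨LinearMap.toMatrix' e.toLinearMap, ?_, ?_⟩
  · rw [LinearMap.det_toMatrix']
    exact LinearEquiv.isUnit_det' e
  · refine Matrix.toLin'.injective (LinearMap.ext fun v => ?_)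
    simpa [Matrix.toLin'_mul] using (he v).symm

end Similarity

/-! ### The manifold of skew orthogonal matrices. -/

section SkewOrthogonalManifold

variable {k : ℕ}

/-- The skew symmetric matrices anticommuting with `J`. -/
def anticommuting (J : SkewMatrix k) : Submodule ℝ (SkewMatrix k) where
  carrier := {W | (W : Matrix (Fin k) (Fin k) ℝ) * (J : Matrix (Fin k) (Fin k) ℝ) +
    (J : Matrix (Fin k) (Fin k) ℝ) * (W : Matrix (Fin k) (Fin k) ℝ) = 0}
  add_mem' := by
    intro A B hA hB
    rw [Set.mem_ofPred_eq] at *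
    rw [Submodule.coe_add, add_mul, mul_add, add_add_add_comm, hA, hB, add_zero]
  zero_mem' := by simp
  smul_mem' := by
    intro c A hA
    rw [Set.mem_ofPred_eq] at *
    rw [Submodule.coe_smul, smul_mul_assoc, mul_smul_comm, ← smul_add, hA, smul_zero]

theorem mem_anticommuting {J W : SkewMatrix k} : W ∈ anticommuting J ↔
    (W : Matrix (Fin k) (Fin k) ℝ) * (J : Matrix (Fin k) (Fin k) ℝ) +
      (J : Matrix (Fin k) (Fin k) ℝ) * (W : Matrix (Fin k) (Fin k) ℝ) = 0 := Iff.rfl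

theorem skewCongr_injective {P : Matrix (Fin k) (Fin k) ℝ} (hP : IsUnit P.det) :
    Function.Injective (skewCongr P) :=
  Function.LeftInverse.injective (g := skewCongr P⁻¹)
    (skewCongr_skewCongr_of_mul_eq_one (Matrix.nonsing_inv_mul _ hP))

/-- Used in both directions to give all charts the same slice dimension. If J'P = PJ with P
invertible, transposing gives PᵀJ' = JPᵀ, so the congruence W ↦ PWPᵀ respects anticommutation; it
preserves skewness even if P is not orthogonal. -/
theorem finrank_anticommuting_le {J J' : SkewMatrix k} (hJ : J ∈ SkewOrthogonal k)
    (hJ' : J' ∈ SkewOrthogonal k) :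
    Module.finrank ℝ (anticommuting J) ≤ Module.finrank ℝ (anticommuting J') := by
  obtain ⟨P, hP, hPJ⟩ := exists_isUnit_det_mul_eq (mem_skewOrthogonal_iff.1 hJ)
    (mem_skewOrthogonal_iff.1 hJ')
  rw [(Submodule.equivMapOfInjective _ (skewCongr_injective hP) (anticommuting J)).finrank_eq]
  refine Submodule.finrank_mono ?_
  rintro _ ⟨W, hW, rfl⟩
  have hPJ' := congrArg Matrix.transpose hPJ
  simp only [Matrix.transpose_mul, transpose_coe_skewMatrix, mul_neg, neg_mul, neg_inj] at hPJ'
  have hW := mem_anticommuting.1 hW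
  rw [mem_anticommuting, coe_skewCongr, mul_assoc, hPJ', ← mul_assoc, ← mul_assoc, ← mul_assoc, hPJ,
    ← add_mul, mul_assoc P, mul_assoc P, ← mul_add, hW, mul_zero, zero_mul]

/-- Inversion of skew symmetric matrices. -/
noncomputable def skewInv (X : SkewMatrix k) : SkewMatrix k := ⟨(X : Matrix (Fin k) (Fin k) ℝ)⁻¹, by
  rw [mem_skewMatrix, Matrix.transpose_nonsing_inv, transpose_coe_skewMatrix]
  by_cases h : IsUnit (X : Matrix (Fin k) (Fin k) ℝ).det
  · exact Matrix.inv_eq_right_inv (by rw [neg_mul_neg, Matrix.mul_nonsing_inv _ h])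
  · rw [Matrix.nonsing_inv_apply_not_isUnit _ h, Matrix.nonsing_inv_apply_not_isUnit, neg_zero]
    rwa [← Matrix.isUnit_iff_isUnit_det, IsUnit.neg_iff, Matrix.isUnit_iff_isUnit_det]⟩

theorem coe_skewInv (X : SkewMatrix k) :
    (skewInv X : Matrix (Fin k) (Fin k) ℝ) = (X : Matrix (Fin k) (Fin k) ℝ)⁻¹ := rfl

/-- The projection of square matrices onto skew symmetric ones. -/
noncomputable def skewProj : Matrix (Fin k) (Fin k) ℝ →ₗ[ℝ] SkewMatrix k where
  toFun X := ⟨skewPart X, transpose_skewPart⟩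
  map_add' X Y := by ext1; simp only [skewPart, Matrix.transpose_add, Submodule.coe_add]; module
  map_smul' c X := by
    ext1; simp only [skewPart, Matrix.transpose_smul, Submodule.coe_smul, RingHom.id_apply]; module

theorem skewProj_coe (X : SkewMatrix k) : skewProj (X : Matrix (Fin k) (Fin k) ℝ) = X := by
  ext1
  change skewPart _ = _
  rw [skewPart, transpose_coe_skewMatrix]
  module

attribute [local instance] Matrix.frobeniusNormedRing Matrix.frobeniusNormedAlgebra in
theorem contDiffAt_matrix_inv {X : Matrix (Fin k) (Fin k) ℝ} (hX : IsUnit X.det) :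
    ContDiffAt ℝ ∞ (fun Y : Matrix (Fin k) (Fin k) ℝ => Y⁻¹) X := by
  obtain ⟨u, rfl⟩ := (Matrix.isUnit_iff_isUnit_det X).2 hX
  simp only [Matrix.nonsing_inv_eq_ringInverse]
  exact contDiffAt_ringInverse ℝ u

theorem contDiffOn_skewInv :
    ContDiffOn ℝ ∞ (skewInv (k := k)) {X | IsUnit (X : Matrix (Fin k) (Fin k) ℝ).det} := by
  have h : skewInv (k := k) = fun X : SkewMatrix k => skewProj ((X : Matrix (Fin k) (Fin k) ℝ)⁻¹) := by
    funext X
    exact (skewProj_coe _).symm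
  rw [h]
  intro X hX
  refine ContDiffAt.contDiffWithinAt ?_
  have h1 : ContDiff ℝ ∞ (skewProj (k := k)) := skewProj.toContinuousLinearMap.contDiff
  have h2 : ContDiff ℝ ∞ (fun X : SkewMatrix k => (X : Matrix (Fin k) (Fin k) ℝ)) :=
    (SkewMatrix k).subtypeL.contDiff
  exact h1.contDiffAt.comp X ((contDiffAt_matrix_inv hX).comp X h2.contDiffAt)

theorem isOpen_isUnit_det :
    IsOpen {X : SkewMatrix k | IsUnit (X : Matrix (Fin k) (Fin k) ℝ).det} := by
  simp only [isUnit_iff_ne_zero]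
  exact isOpen_ne_fun (Continuous.matrix_det continuous_subtype_val) continuous_const

theorem skewInv_skewInv {X : SkewMatrix k} (hX : IsUnit (X : Matrix (Fin k) (Fin k) ℝ).det) :
    skewInv (skewInv X) = X :=
  Subtype.ext (Matrix.nonsing_inv_nonsing_inv _ hX)

theorem isUnit_det_skewInv {X : SkewMatrix k} (hX : IsUnit (X : Matrix (Fin k) (Fin k) ℝ).det) :
    IsUnit (skewInv X : Matrix (Fin k) (Fin k) ℝ).det :=
  Matrix.isUnit_nonsing_inv_det _ hX

/-- The chart of the space of skew symmetric matrices given by inversion centred at `-J`. -/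
noncomputable def skewInvChart (J : SkewMatrix k) : OpenPartialHomeomorph (SkewMatrix k) (SkewMatrix k) where
  -- For J² = -1 the shift by J/2 turns the affine condition YJ + JY = 1 on Y = (X + J)⁻¹ into a
  -- linear one, and sends X = J to 0.
  toFun X := skewInv (X + J) + (1 / 2 : ℝ) • J
  invFun W := skewInv (W - (1 / 2 : ℝ) • J) - J
  source := {X | IsUnit ((X + J : SkewMatrix k) : Matrix (Fin k) (Fin k) ℝ).det}
  target := {W | IsUnit ((W - (1 / 2 : ℝ) • J : SkewMatrix k) : Matrix (Fin k) (Fin k) ℝ).det}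
  map_source' X hX := by
    rw [Set.mem_ofPred_eq, add_sub_cancel_right]
    exact isUnit_det_skewInv hX
  map_target' W hW := by
    rw [Set.mem_ofPred_eq, sub_add_cancel]
    exact isUnit_det_skewInv hW
  left_inv' X hX := by rw [add_sub_cancel_right, skewInv_skewInv hX, add_sub_cancel_right]
  right_inv' W hW := by rw [sub_add_cancel, skewInv_skewInv hW, sub_add_cancel]
  open_source := isOpen_isUnit_det.preimage (continuous_id.add continuous_const)
  open_target := isOpen_isUnit_det.preimage (continuous_id.sub continuous_const)
  continuousOn_toFun := (contDiffOn_skewInv.continuousOn.comp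
    (continuous_id.add continuous_const).continuousOn fun _ hX => hX).add continuousOn_const
  continuousOn_invFun := (contDiffOn_skewInv.continuousOn.comp
    (continuous_id.sub continuous_const).continuousOn fun _ hX => hX).sub continuousOn_const

/-- With Y = (X + J)⁻¹ and J² = -1, X² + 1 = -(X + J)(YJ + JY - 1)(X + J), and the outer factors are
invertible. -/
theorem skewInvChart_mem_anticommuting_iff {J X : SkewMatrix k} (hJ : J ∈ SkewOrthogonal k)
    (hX : X ∈ (skewInvChart J).source) :
    skewInvChart J X ∈ anticommuting J ↔ X ∈ SkewOrthogonal k := by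
  have hX : IsUnit ((X + J : SkewMatrix k) : Matrix (Fin k) (Fin k) ℝ).det := hX
  have hc : skewInvChart J X = skewInv (X + J) + (1 / 2 : ℝ) • J := rfl
  rw [mem_skewOrthogonal_iff] at *
  rw [mem_anticommuting, hc, Submodule.coe_add, Submodule.coe_smul, coe_skewInv]
  have h1 := Matrix.mul_nonsing_inv _ hX
  have h2 := Matrix.nonsing_inv_mul _ hX
  generalize ((X + J : SkewMatrix k) : Matrix (Fin k) (Fin k) ℝ)⁻¹ = Y at *
  rw [Submodule.coe_add] at h1 h2
  generalize (X : Matrix (Fin k) (Fin k) ℝ) = X at *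
  generalize (J : Matrix (Fin k) (Fin k) ℝ) = J at *
  have e1 : (Y + (1 / 2 : ℝ) • J) * J + J * (Y + (1 / 2 : ℝ) • J) = Y * J + J * Y - 1 := by
    rw [add_mul, mul_add, smul_mul_assoc, mul_smul_comm, hJ]
    module
  have e2 : X * X + 1 = -((X + J) * (Y * J + J * Y - 1) * (X + J)) := by
    have : (X + J) * (Y * J + J * Y - 1) * (X + J) =
        ((X + J) * Y) * (J * (X + J)) + ((X + J) * J) * (Y * (X + J)) - (X + J) * (X + J) := by
      noncomm_ring
    have h3 : X * X + 1 = X * X - J * J := by rw [hJ, sub_neg_eq_add]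
    rw [this, h1, h2, h3]
    noncomm_ring
  have e3 : Y * J + J * Y - 1 = -(Y * (X * X + 1) * Y) := by
    rw [e2]
    have : -(Y * -((X + J) * (Y * J + J * Y - 1) * (X + J)) * Y) =
      (Y * (X + J)) * (Y * J + J * Y - 1) * ((X + J) * Y) := by noncomm_ring
    rw [this, h1, h2, one_mul, mul_one]
  rw [e1, ← add_eq_zero_iff_eq_neg]
  constructor
  · intro h
    rw [e2, h]; simp
  · intro h
    rw [e3, h]; simp

theorem isEmbeddedSubmanifold_skewOrthogonal (k : ℕ) :
    IsEmbeddedSubmanifold (SkewOrthogonal k) := by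
  rcases (SkewOrthogonal k).eq_empty_or_nonempty with h | ⟨J₀, hJ₀⟩
  -- With no skew orthogonal matrices of order k, any dimension serves.
  · exact ⟨0, by simp [h]⟩
  refine ⟨Module.finrank ℝ (anticommuting J₀), fun J hJ =>
    ⟨skewInvChart J, anticommuting J, ?_, ?_, ?_,
      le_antisymm (finrank_anticommuting_le hJ hJ₀) (finrank_anticommuting_le hJ₀ hJ), ?_⟩⟩
  -- J lies in its own chart domain: 2J has inverse -J/2.
  · change IsUnit ((J + J : SkewMatrix k) : Matrix (Fin k) (Fin k) ℝ).det
    refine Matrix.isUnit_det_of_right_inverse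
      (B := (-(1 / 2 : ℝ)) • (J : Matrix (Fin k) (Fin k) ℝ)) ?_
    rw [Submodule.coe_add, mul_smul_comm, add_mul, mem_skewOrthogonal_iff.1 hJ]
    module
  · exact (contDiffOn_skewInv.comp (contDiff_id.add contDiff_const).contDiffOn
      fun _ hX => hX).add contDiffOn_const
  · exact (contDiffOn_skewInv.comp (contDiff_id.sub contDiff_const).contDiffOn
      fun _ hX => hX).sub contDiffOn_const
  · ext W
    constructor
    · rintro ⟨X, ⟨hX, hXS⟩, rfl⟩
      exact ⟨(skewInvChart J).map_source hX, (skewInvChart_mem_anticommuting_iff hJ hX).2 hXS⟩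
    · rintro ⟨hW, hWV⟩
      have hs := (skewInvChart J).map_target hW
      refine ⟨(skewInvChart J).symm W, ⟨hs, (skewInvChart_mem_anticommuting_iff hJ hs).1 ?_⟩,
        (skewInvChart J).right_inv hW⟩
      rwa [(skewInvChart J).right_inv hW]

end SkewOrthogonalManifold

/-! ### Assembly of the theorem. -/

theorem mainTheorem3 (n : ℕ) (R : Matrix (Fin n) (Fin n) ℝ)
    (hR : R ∈ Matrix.specialOrthogonalGroup (Fin n) ℝ) :
    (¬ Module.End.HasEigenvalue (Matrix.toLin' R) (-1) →
      ∃! B : SkewMatrix n, B ∈ Aplog R) ∧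
    (Module.End.HasEigenvalue (Matrix.toLin' R) (-1) →
      ∃ m₁ : ℕ, 1 ≤ m₁ ∧ R.charpoly.rootMultiplicity (-1) = 2 * m₁ ∧
        IsEmbeddedSubmanifold (SkewOrthogonal (2 * m₁)) ∧
        IsEmbeddedSubmanifold (Aplog R) ∧
        AreDiffeomorphic (Aplog R) (SkewOrthogonal (2 * m₁)) ∧
        ∀ (p : ℕ) (B : SkewMatrix n) (θ : Fin p → ℝ) (C : Fin p → SkewMatrix n),
          B ∈ Aplog R → IsSVD B θ C →
          ∃ k : Fin p, θ k = π ∧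
            Aplog R = {A : SkewMatrix n | ∃ W : SkewMatrix n,
              IsSVDSystem (Function.update C k W) ∧
              (W : Matrix (Fin n) (Fin n) ℝ) ^ 2 = (C k : Matrix (Fin n) (Fin n) ℝ) ^ 2 ∧
              A = π • W + ∑ j ∈ Finset.univ.erase k, θ j • C j}) := by
  rw [Matrix.mem_specialOrthogonalGroup_iff] at hR
  obtain ⟨hO, hdet⟩ := hR
  have hR1 : R * Rᵀ = 1 := (Matrix.mem_orthogonalGroup_iff _ _).1 hO
  have hR2 : Rᵀ * R = 1 := (Matrix.mem_orthogonalGroup_iff' _ _).1 hO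
  obtain ⟨P, L, h⟩ := exists_isLogSplitting hR1 hR2
  refine ⟨h.existsUnique, fun hev => ?_⟩
  obtain ⟨U, hU, hU'⟩ := h.exists_frame
  have hmult := h.rootMultiplicity_charpoly hR2
  have hpos : 0 < Module.finrank ℝ (Module.End.eigenspace (Matrix.toLin' R) (-1)) := by
    rw [Module.finrank_pos_iff, Submodule.nontrivial_iff_ne_bot]
    exact hev
  generalize Module.finrank ℝ (Module.End.eigenspace (Matrix.toLin' R) (-1)) = m at *
  obtain ⟨m₁, hm⟩ := h.even_of_frame hdet hU hU'
  obtain rfl : m = 2 * m₁ := by omega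
  have himage := h.aplog_eq_image hU hU'
  -- The linear left inverse B ↦ π⁻¹UᵀBU, required by the transfer of submanifolds and
  -- diffeomorphisms along affine maps.
  have hretract : ∀ M, (π⁻¹ • skewCongr Uᵀ) ((π • skewCongr U) M) = M := fun M => by
    rw [LinearMap.smul_apply, LinearMap.smul_apply, map_smul, smul_smul,
      inv_mul_cancel₀ pi_ne_zero, one_smul, skewCongr_skewCongr_of_mul_eq_one hU]
  refine ⟨m₁, by omega, hmult, isEmbeddedSubmanifold_skewOrthogonal _, ?_, ?_, ?_⟩
  · rw [himage]
    exact (isEmbeddedSubmanifold_skewOrthogonal _).affine_image _ _ _ hretract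
  · rw [himage]
    exact areDiffeomorphic_affine_image _ _ _ _ hretract
  · intro p B θ C hB hSVD
    obtain ⟨k, hk⟩ := hSVD.exists_eq_pi h hB (h.proj_ne_zero hev)
    exact ⟨k, hk, hSVD.aplog_eq h hB (h.proj_ne_zero hev) hk⟩
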